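/- Formulas are built from countably many propositional variables with a unary connective $\neg$ and a binary connective $\to$; write $\varphi\oplus\psi=\neg\varphi\to\psi$, $\varphi\otimes\psi=\neg(\varphi\to\neg\psi)$, $\varphi\wedge\psi=\neg((\neg\varphi\to\neg\psi)\to\neg\psi)$, $i\varphi=\varphi\oplus\cdots\oplus\varphi$ and $\varphi^i=\varphi\otimes\cdots\otimes\varphi$ ($i$ times), and let $\bot$ be any formula $\neg(\chi\to\chi)$. A \emph{logic} is a substitution-invariant Tarskian consequence relation between sets of formulas and formulas; logics are ordered by inclusion of consequence relations. A logic $L_1$ is \emph{strongly maximal} with respect to $L_2$ if $L_1\subsetneq L_2$ and, for every finitary rule $\varphi_1,\dots,\varphi_n/\psi$ that is valid in $L_2$ but not in $L_1$, the least logic extending $L_1$ in which this rule is valid coincides with $L_2$. For $n\ge 1$ let $\mathbf{LV}_{n+1}$ be the algebra on $\{0,\frac1n,\dots,\frac{n-1}n,1\}$ with $\neg x=1-x$ and $x\to y=\min\{1,1-x+y\}$, and let $F_{i/n}=\{x : x\ge i/n\}$. Let $\mathsf L^i_n$ be the logic of the matrix $\langle\mathbf{LV}_{n+1},F_{i/n}\rangle$,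 let $\mathsf{CPL}=\mathsf L^1_1$, and let $\bar{\mathsf L}^i_n$ be the logic of the matrix $\langle\mathbf{LV}_{n+1}\times\mathbf{LV}_2,\,F_{i/n}\times\{1\}\rangle$. Let $\mathsf H^n_n$ be the Hilbert calculus with modus ponens and Łukasiewicz's axioms $\varphi\to(\psi\to\varphi)$, $(\varphi\to\psi)\to((\psi\to\chi)\to(\varphi\to\chi))$, $((\varphi\to\psi)\to\psi)\to((\psi\to\varphi)\to\varphi)$, $(\neg\varphi\to\neg\psi)\to(\psi\to\varphi)$, $((\varphi\to\psi)\to(\psi\to\varphi))\to(\psi\to\varphi)$, together with both implications of $\varphi^n\leftrightarrow\varphi^{n+1}$ and, for $2\le h<n$ with $h\nmid n$, of $(n+1)\varphi^h\leftrightarrow(h\,\varphi^{h-1})^{n+1}$. For $0<i<n$ let $\mathsf H^i_n$ be the calculus whose rules are $\gamma_1^n,\dots,\gamma_m^n/\psi^n$ for each axiom or rule $\gamma_1,\dots,\gamma_m/\psi$ of $\mathsf H^n_n$, together with $\varphi/(\lambda_{i,n}(\varphi))^n$ and $(\lambda_{i,n}(\varphi))^n/\varphi$, where $\lambda_{i,n}$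 is a formula in one variable defining $x\mapsto\min\{1,\max\{0,nx-(i-1)\}\}$. For a calculus $\mathsf H$ denote by $\mathsf H+(exp_j)$ its extension by the $j$-explosion rule $j(\varphi\wedge\neg\varphi)/\bot$, and put $\overline{\mathsf H}^j_q=\mathsf H^j_q+(exp_j)$. Soundness and completeness refer to arbitrary sets of premises. \textbf{Statement.} Let $q$ be a prime number and $0<j\le q$. Then: \begin{itemize} \item $\mathsf L^j_q$, $\bar{\mathsf L}^j_q$ and $\mathsf{CPL}$ are finitary, and a logic $L$ satisfies $\mathsf L^j_q\subsetneq L\subsetneq\mathsf{CPL}$ if and only if $L=\bar{\mathsf L}^j_q$; \item a logic $L\supseteq\mathsf L^j_q$ is strongly maximal with respect to $\mathsf{CPL}$ if and only if $L=\bar{\mathsf L}^j_q$; \item $\mathsf H^j_q$ is sound and complete for $\mathsf L^j_q$, and $\overline{\mathsf H}^j_q$ is sound and complete for $\bar{\mathsf L}^j_q$; moreover, for every Hilbert calculus $\mathsf H$ (set of finitary rule schemes) that is sound and complete for $\mathsf L^j_q$, the calculus $\mathsf H+(exp_j)$ is sound and complete for $\bar{\mathsf L}^j_q$. \end{itemize}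 -/

import Mathlib

namespace FinLuk

/-- Formulas over the signature with a unary negation and a binary implication, with countably many
propositional variables. -/
inductive Fm : Type
  | var : ℕ → Fm
  | neg : Fm → Fm
  | imp : Fm → Fm → Fm

namespace Fm

/-- Simultaneous substitution of formulas for variables. -/
def subst (s : ℕ → Fm) : Fm → Fm
  | var n => s n
  | neg a => neg (subst s a)
  | imp a b => imp (subst s a) (subst s b)

/-- The formula `¬(a → a)`, which takes the value `0` under every evaluation. -/
def falsum (a : Fm) : Fm := neg (imp a a)

/-- Strong conjunction `¬(a → ¬b)`. -/
def otimes (a b : Fm) : Fm := neg (imp a (neg b))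

/-- Strong disjunction `¬a → b`. -/
def oplus (a b : Fm) : Fm := imp (neg a) b

/-- Lattice conjunction `¬((¬a → ¬b) → ¬b)`. -/
def conj (a b : Fm) : Fm := neg (imp (imp (neg a) (neg b)) (neg b))

/-- `nmul i a` is the formula `a ⊕ ⋯ ⊕ a` (`i` times). -/
def nmul : ℕ → Fm → Fm
  | 0, a => falsum a
  | 1, a => a
  | (i + 2), a => oplus (nmul (i + 1) a) a

/-- `npow i a` is the formula `a ⊗ ⋯ ⊗ a` (`i` times). -/
def npow : ℕ → Fm → Fm
  | 0, a => imp a a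
  | 1, a => a
  | (i + 2), a => otimes (npow (i + 1) a) a

/-- `lin n k a` has the value `min 1 (max 0 (n * x - k))` when `a` has the value `x`. -/
def lin : ℕ → ℕ → Fm → Fm
  | 0, _, a => falsum a
  | (n + 1), 0, a => oplus (lin n 0 a) a
  | (n + 1), (k + 1), a => otimes (oplus (lin n (k + 1) a) a) (lin n k a)

/-- For `1 ≤ i ≤ n`, the McNaughton function `0` below `(i-1)/n`, `n x - (i-1)` on
`[(i-1)/n, i/n]`, and `1` above `i/n`; on the `(n+1)`-element chain it is the characteristic
function of `{x | i/n ≤ x}`. -/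
def lam (i n : ℕ) (a : Fm) : Fm := lin n (i - 1) a

end Fm

/-- A propositional logic: a structural (substitution invariant) Tarskian consequence relation on
formulas. Monotonicity follows from `refl` and `cut`. -/
@[ext]
structure PropLogic where
  entails : Set Fm → Fm → Prop
  refl : ∀ Γ φ, φ ∈ Γ → entails Γ φ
  cut : ∀ Γ Δ φ, (∀ ψ ∈ Δ, entails Γ ψ) → entails Δ φ → entails Γ φ
  structural : ∀ (s : ℕ → Fm) Γ φ, entails Γ φ → entails (Fm.subst s '' Γ) (Fm.subst s φ)

/-- Logics are ordered by inclusion of their consequence relations. -/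
instance : PartialOrder PropLogic :=
  PartialOrder.lift PropLogic.entails (fun _ _ h => PropLogic.ext h)

theorem PropLogic.le_iff (L L' : PropLogic) :
    L ≤ L' ↔ ∀ Γ φ, L.entails Γ φ → L'.entails Γ φ := Iff.rfl

/-- Finitary logics (a standard logic is a finitary `PropLogic`). -/
def PropLogic.IsFinitary (L : PropLogic) : Prop :=
  ∀ Γ φ, L.entails Γ φ → ∃ Δ : Set Fm, Δ ⊆ Γ ∧ Δ.Finite ∧ L.entails Δ φ

/-- A finitary rule `φ₁, …, φₙ / ψ`. An axiom is a rule without premises. -/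
structure FRule where
  prems : List Fm
  concl : Fm

/-- The rule `r` is valid in the logic `L`. -/
def PropLogic.Validates (L : PropLogic) (r : FRule) : Prop :=
  L.entails {φ | φ ∈ r.prems} r.concl

/-- The logic obtained from `L` by adding `r` as a structural rule: the least logic that extends
`L` and in which `r` (hence each of its substitution instances) is valid. -/
def PropLogic.addRule (L : PropLogic) (r : FRule) : PropLogic where
  entails Γ φ := ∀ L' : PropLogic, L ≤ L' → L'.Validates r → L'.entails Γ φ
  refl Γ φ h L' _ _ := L'.refl Γ φ h
  cut Γ Δ φ h₁ h₂ L' hL hr :=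
    L'.cut Γ Δ φ (fun ψ hψ => h₁ ψ hψ L' hL hr) (h₂ L' hL hr)
  structural s Γ φ h L' hL hr := L'.structural s Γ φ (h L' hL hr)

/-- `L₁` is strongly maximal with respect to `L₂`. -/
def StronglyMaximal (L₁ L₂ : PropLogic) : Prop :=
  L₁ < L₂ ∧ ∀ r : FRule, L₂.Validates r → ¬ L₁.Validates r → L₁.addRule r = L₂

/-- A logical matrix over the signature: an algebra with a set of designated elements. -/
structure LMatrix where
  Carrier : Type
  neg : Carrier → Carrier
  imp : Carrier → Carrier → Carrier
  des : Set Carrier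

namespace LMatrix

/-- The homomorphism from the formula algebra that extends an assignment of the variables. -/
def eval (M : LMatrix) (e : ℕ → M.Carrier) : Fm → M.Carrier
  | .var n => e n
  | .neg a => M.neg (eval M e a)
  | .imp a b => M.imp (eval M e a) (eval M e b)

theorem eval_subst (M : LMatrix) (e : ℕ → M.Carrier) (s : ℕ → Fm) (a : Fm) :
    M.eval e (a.subst s) = M.eval (fun n => M.eval e (s n)) a := by
  induction a with
  | var n => rfl
  | neg a ih => simp [Fm.subst, eval, ih]
  | imp a b iha ihb => simp [Fm.subst, eval, iha, ihb]

/-- The logic defined by a logical matrix. -/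
def logic (M : LMatrix) : PropLogic where
  entails Γ φ := ∀ e : ℕ → M.Carrier, (∀ ψ ∈ Γ, M.eval e ψ ∈ M.des) → M.eval e φ ∈ M.des
  refl _ φ h _ he := he φ h
  cut _ _ _ h₁ h₂ e he := h₂ e (fun ψ hψ => h₁ ψ hψ e he)
  structural s Γ φ h e he := by
    rw [eval_subst]
    refine h _ (fun ψ hψ => ?_)
    rw [← eval_subst]
    exact he _ ⟨ψ, hψ, rfl⟩

/-- The product of two matrices. -/
def prod (M N : LMatrix) : LMatrix where
  Carrier := M.Carrier × N.Carrier
  neg x := (M.neg x.1, N.neg x.2)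
  imp x y := (M.imp x.1 y.1, N.imp x.2 y.2)
  des := M.des ×ˢ N.des

end LMatrix

/-- The set of truth values `{0, 1/n, …, (n-1)/n, 1}`. -/
def LV (n : ℕ) : Set ℚ := {x | ∃ k : ℕ, k ≤ n ∧ x = (k : ℚ) / n}

theorem neg_mem_LV (n : ℕ) [NeZero n] {x : ℚ} (hx : x ∈ LV n) : 1 - x ∈ LV n := by
  obtain ⟨k, hk, rfl⟩ := hx
  have hn : (n : ℚ) ≠ 0 := Nat.cast_ne_zero.mpr (NeZero.ne n)
  refine ⟨n - k, Nat.sub_le _ _, ?_⟩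
  rw [Nat.cast_sub hk]
  field_simp

theorem imp_mem_LV (n : ℕ) [NeZero n] {x y : ℚ} (hx : x ∈ LV n) (hy : y ∈ LV n) :
    min 1 (1 - x + y) ∈ LV n := by
  obtain ⟨k, hk, rfl⟩ := hx
  obtain ⟨l, hl, rfl⟩ := hy
  have hn : (n : ℚ) ≠ 0 := Nat.cast_ne_zero.mpr (NeZero.ne n)
  have hn' : (0 : ℚ) < n := Nat.cast_pos.mpr (NeZero.pos n)
  rcases le_total k l with h | h
  · refine ⟨n, le_rfl, ?_⟩
    have h' : (k : ℚ) / n ≤ (l : ℚ) / n :=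
      div_le_div_of_nonneg_right (Nat.cast_le.mpr h) hn'.le
    rw [div_self hn, min_eq_left]
    linarith
  · refine ⟨n - k + l, by omega, ?_⟩
    have h' : (l : ℚ) / n ≤ (k : ℚ) / n :=
      div_le_div_of_nonneg_right (Nat.cast_le.mpr h) hn'.le
    rw [Nat.cast_add, Nat.cast_sub hk, min_eq_right (by linarith)]
    field_simp

/-- The `(n+1)`-element Łukasiewicz chain with the order filter `{x | i/n ≤ x}` as its set of
designated elements. -/
def chainMatrix (i n : ℕ) [NeZero n] : LMatrix where
  Carrier := LV n
  neg x := ⟨1 - x.1, neg_mem_LV n x.2⟩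
  imp x y := ⟨min 1 (1 - x.1 + y.1), imp_mem_LV n x.2 y.2⟩
  des := {x | (i : ℚ) / n ≤ x.1}

/-- The logic `𝖫ⁱₙ`. -/
def lukLogic (i n : ℕ) [NeZero n] : PropLogic := (chainMatrix i n).logic

/-- Classical propositional logic, given by the two-element matrix. -/
def CPL : PropLogic := lukLogic 1 1

/-- The logic `𝖫̄ⁱₙ`, given by the product of the `(n+1)`-element chain with filter `{x | i/n ≤ x}`
and the two-element chain with filter `{1}`. -/
def lukBarLogic (i n : ℕ) [NeZero n] : PropLogic :=
  ((chainMatrix i n).prod (chainMatrix 1 1)).logic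

/-- A Hilbert calculus: a set of finitary rule schemes (axioms have no premises). -/
abbrev HilbertCalculus : Type := Set FRule

/-- `H.Derives Γ φ`: there is a proof of `φ` from the hypotheses `Γ` by substitution instances of
the rules of `H`. -/
inductive HilbertCalculus.Derives (H : HilbertCalculus) (Γ : Set Fm) : Fm → Prop
  | hyp (φ : Fm) : φ ∈ Γ → Derives H Γ φ
  | rule (r : FRule) (s : ℕ → Fm) : r ∈ H → (∀ ψ ∈ r.prems, Derives H Γ (ψ.subst s)) →
      Derives H Γ (r.concl.subst s)

/-- The calculus `H` is (strongly) sound and complete for the logic `L`. -/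
def HilbertCalculus.SoundComplete (H : HilbertCalculus) (L : PropLogic) : Prop :=
  ∀ Γ φ, HilbertCalculus.Derives H Γ φ ↔ L.entails Γ φ

section Calculi

open Fm

/-- The axiom schemes of the `(n+1)`-valued Łukasiewicz logic: Łukasiewicz's axioms for the
infinite-valued logic, followed by Grigolia's axioms `φⁿ ↔ φⁿ⁺¹` and, for each `2 ≤ h < n` that
does not divide `n`, `(n+1) φʰ ↔ (h φʰ⁻¹)ⁿ⁺¹`. -/
inductive LukAxiom (n : ℕ) : Fm → Prop
  | weakening : LukAxiom n (imp (var 0) (imp (var 1) (var 0)))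
  | transitivity :
      LukAxiom n (imp (imp (var 0) (var 1)) (imp (imp (var 1) (var 2)) (imp (var 0) (var 2))))
  | join_comm :
      LukAxiom n (imp (imp (imp (var 0) (var 1)) (var 1)) (imp (imp (var 1) (var 0)) (var 0)))
  | contraposition :
      LukAxiom n (imp (imp (neg (var 0)) (neg (var 1))) (imp (var 1) (var 0)))
  | linearity :
      LukAxiom n (imp (imp (imp (var 0) (var 1)) (imp (var 1) (var 0))) (imp (var 1) (var 0)))
  | contraction : LukAxiom n (imp (npow n (var 0)) (npow (n + 1) (var 0)))
  | contraction_conv : LukAxiom n (imp (npow (n + 1) (var 0)) (npow n (var 0)))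
  | divisor (h : ℕ) : 2 ≤ h → h < n → ¬ h ∣ n →
      LukAxiom n (imp (nmul (n + 1) (npow h (var 0))) (npow (n + 1) (nmul h (npow (h - 1) (var 0)))))
  | divisor_conv (h : ℕ) : 2 ≤ h → h < n → ¬ h ∣ n →
      LukAxiom n (imp (npow (n + 1) (nmul h (npow (h - 1) (var 0)))) (nmul (n + 1) (npow h (var 0))))

/-- The usual Hilbert calculus of the `(n+1)`-valued Łukasiewicz logic (designated value `1`), with
modus ponens as its only proper rule. -/
def lukCalculus (n : ℕ) : HilbertCalculus :=
  {r | r.prems = [] ∧ LukAxiom n r.concl} ∪ {⟨[var 0, imp (var 0) (var 1)], var 1⟩}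

/-- The translation of the calculus of the `(n+1)`-valued Łukasiewicz logic along the equivalence
of deductive systems `τ(p) = λ_{i,n}(p)`, `σ(p) = pⁿ`: each rule `Γ / φ` becomes `σ(Γ) / σ(φ)`, and
the rules `p / σ(τ(p))` and `σ(τ(p)) / p` are added. -/
def translatedCalculus (i n : ℕ) : HilbertCalculus :=
  {r | ∃ r₀ ∈ lukCalculus n, r = ⟨r₀.prems.map (npow n), npow n r₀.concl⟩} ∪
    {⟨[var 0], npow n (lam i n (var 0))⟩, ⟨[npow n (lam i n (var 0))], var 0⟩}

/-- The Hilbert calculus `𝖧ⁱₙ` for `𝖫ⁱₙ`. -/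
def hilbertL (i n : ℕ) : HilbertCalculus :=
  if i = n then lukCalculus n else translatedCalculus i n

/-- The `i`-explosion rule `i (φ ∧ ¬φ) / ⊥`. -/
def expRule (i : ℕ) : FRule := ⟨[nmul i (conj (var 0) (neg (var 0)))], falsum (var 1)⟩

/-- The calculus obtained from `H` by adding the `i`-explosion rule. -/
def addExp (H : HilbertCalculus) (i : ℕ) : HilbertCalculus := insert (expRule i) H

end Calculi

end FinLuk

open FinLuk

/-!
The argument has two independent halves: the position of `𝖫̄ʲ_q` between `𝖫ʲ_q` and classical logic,
and the completeness of the calculi.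

*The interval.* Call a truth value classical if it is `0` or `1`. Since `q` is prime, every
nonclassical element of the chain generates it, and the terms `lin N K` separate its points. Hence
for every chain value `x` and Boolean value `b` some unary formula takes the value `x` at all
nonclassical arguments and `b` at the classical ones (`exists_term`). So a pair of evaluations, the
second one classical, can be merged into a single substitution by formulas in one variable
(`exists_subst`). On the other hand, the premise `j (φ ∧ ¬φ)` of the explosion rule is designated
exactly when `φ` is nonclassical (`le_val_explosion_iff`). Let `L` extend `𝖫ʲ_q`.

* If explosion fails in `L`, then `L` is `𝖫ʲ_q`: a substitution that reproduces a counterexample at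
  each nonclassical value would derive explosion from any new entailment
  (`le_lukLogic_of_not_validates`).
* If explosion holds in `L`, then `L` extends `𝖫̄ʲ_q`: classically unsatisfiable premises entail, by
  compactness, that some formula is nonclassical (`lukBarLogic_le_of_validates`).
* If moreover `L` is contained in classical logic and is not `𝖫̄ʲ_q`, then merging the two
  coordinates of a counterexample gives a theorem of `L` in one variable that is designated only at
  classical values, and all of classical logic follows (`CPL_le_of_ne`).

None of this assumes `L` finitary. Uniqueness, strong maximality and the statement about
`H + (exp_j)` are formal consequences.

*Completeness.* A maximal set of formulas not deriving `φ` is a theory whose Lindenbaum algebra is,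
by the linearity axiom and the local deduction theorem, a Wajsberg chain. The contraction axiom
makes it simple of bounded exponent, so it has a coatom `c` (`WajsbergAlgebra.exists_coatom`), and
counting how many implications `c → ⋯` lift an element to `1` embeds it into the rational unit
interval with image `{0, 1/m, …, 1}`, `m ≤ n` (`WajsbergAlgebra.exists_depth`). The divisor axioms
give `m ∣ n` (`LukTheory.dvd_of_val_eq`), so the chain embeds into `LV n`. For designated sets
other than `{1}`, derivations are transferred along `φ ↦ λ(φ)` and `φ ↦ φⁿ`
(`logic_translatedCalculus`).
-/

namespace FinLuk

/-! ### Wajsberg algebras -/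

/-- Wajsberg algebras, the implicational presentation of MV-algebras. The axioms are those that are
immediate for Lindenbaum algebras: `imp x y = one` is the order relation, and its antisymmetry and
modus ponens replace the usual identity `imp one x = x`, which follows. -/
class WajsbergAlgebra (A : Type*) where
  imp : A → A → A
  neg : A → A
  one : A
  weakening : ∀ x y, imp x (imp y x) = one
  transitivity : ∀ x y z, imp (imp x y) (imp (imp y z) (imp x z)) = one
  join_comm : ∀ x y, imp (imp x y) y = imp (imp y x) x
  contraposition : ∀ x y, imp (imp (neg x) (neg y)) (imp y x) = one
  antisymm : ∀ x y, imp x y = one → imp y x = one → x = y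
  mp : ∀ x, imp one x = one → x = one

namespace WajsbergAlgebra

local infixr:60 " ⇾ " => WajsbergAlgebra.imp

variable {A : Type*} [WajsbergAlgebra A]

theorem trans' {x y z : A} (h₁ : x ⇾ y = one) (h₂ : y ⇾ z = one) : x ⇾ z = one := by
  have h := transitivity x y z
  rw [h₁, h₂] at h
  exact mp _ (mp _ h)

theorem imp_one (x : A) : x ⇾ (one : A) = one := mp _ (weakening one x)

theorem imp_imp_self (x y : A) : x ⇾ ((x ⇾ y) ⇾ y) = one := by
  rw [join_comm]
  exact weakening x _

theorem one_imp (x : A) : (one : A) ⇾ x = x :=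
  antisymm _ _ (mp _ (imp_imp_self one x)) (weakening x one)

theorem imp_self (x : A) : x ⇾ x = one := by
  have h := weakening x one
  rwa [one_imp] at h

instance : PartialOrder A where
  le x y := x ⇾ y = one
  le_refl := imp_self
  le_trans _ _ _ := trans'
  le_antisymm := antisymm

theorem le_iff {x y : A} : x ≤ y ↔ x ⇾ y = one := Iff.rfl

theorem one_le_iff {x : A} : one ≤ x ↔ x = one := by rw [le_iff, one_imp]

theorem imp_le_imp_left {x y : A} (h : x ≤ y) (z : A) : y ⇾ z ≤ x ⇾ z := by
  have h' := transitivity x y z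
  rw [le_iff.1 h] at h'
  exact mp _ h'

theorem exchange_le (x y z : A) : x ⇾ y ⇾ z ≤ y ⇾ x ⇾ z :=
  le_trans (transitivity x (y ⇾ z) z) (imp_le_imp_left (imp_imp_self y z) _)

theorem exchange (x y z : A) : x ⇾ y ⇾ z = y ⇾ x ⇾ z :=
  le_antisymm (exchange_le x y z) (exchange_le y x z)

theorem le_imp_comm {x y z : A} : x ≤ y ⇾ z ↔ y ≤ x ⇾ z := by
  rw [le_iff, exchange, le_iff]

theorem imp_le_imp_right (x : A) {y z : A} (h : y ≤ z) : x ⇾ y ≤ x ⇾ z := by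
  have h' := le_imp_comm.1 (transitivity x y z)
  rw [le_iff.1 h] at h'
  exact one_le_iff.1 h'

theorem self_le_imp (x y : A) : y ≤ x ⇾ y := weakening y x

/-- The least element. -/
def zero : A := neg (one : A)

theorem zero_le (x : A) : zero ≤ x := by
  have h : neg x ⇾ neg one ≤ (one : A) ⇾ x := contraposition x one
  rw [one_imp] at h
  exact le_trans (self_le_imp (neg x) _) h

theorem neg_neg_le (x : A) : neg (neg x) ≤ x := by
  have h : neg x ⇾ neg one ≤ (one : A) ⇾ x := contraposition x one
  rw [one_imp] at h
  refine le_trans (le_trans (self_le_imp (neg zero) _) ?_) h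
  exact contraposition zero (neg x)

theorem neg_eq (x : A) : neg x = x ⇾ zero := by
  refine le_antisymm (le_trans (self_le_imp (neg zero) _) (contraposition zero x)) ?_
  refine le_trans (imp_le_imp_left (neg_neg_le x) _) ?_
  have h : neg (neg x) ⇾ neg one ≤ (one : A) ⇾ neg x := contraposition (neg x) one
  rwa [one_imp] at h

theorem neg_neg (x : A) : neg (neg x) = x := by
  rw [neg_eq, neg_eq, join_comm, le_iff.1 (zero_le x), one_imp]

theorem neg_imp_neg (x y : A) : neg x ⇾ neg y = y ⇾ x := by
  rw [neg_eq y, exchange, ← neg_eq, neg_neg]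

/-- Residuation for the strong conjunction `¬(x → ¬y)`. -/
theorem otimes_imp (x y z : A) : neg (x ⇾ neg y) ⇾ z = x ⇾ y ⇾ z := by
  conv_lhs => rw [← neg_neg z, neg_imp_neg, exchange, neg_imp_neg]

/-- Divisibility: `c ⊗ (c → x) = x` for `x ≤ c`. -/
theorem otimes_imp_of_le {c x : A} (h : x ≤ c) : neg (c ⇾ neg (c ⇾ x)) = x := by
  have h' : neg c ⇾ neg x = one := by rw [neg_imp_neg]; exact h
  have h'' : c ⇾ neg (c ⇾ x) = (c ⇾ x) ⇾ neg c := by rw [neg_eq, exchange, ← neg_eq]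
  rw [h'', ← neg_imp_neg x c, join_comm, h', one_imp, neg_neg]

/-- Below `c` the operation `c → ⋯` is an order embedding, as truncated addition of `1 - c`. -/
theorem imp_imp_imp_cancel {c x : A} (h : x ≤ c) (y : A) : (c ⇾ x) ⇾ (c ⇾ y) = x ⇾ y := by
  rw [exchange, ← otimes_imp, otimes_imp_of_le h]

/-! ### Iterated implications -/

theorem imp_iterate_mono (x : A) (k : ℕ) : Monotone (fun y => (x ⇾ ·)^[k] y) :=
  Monotone.iterate (fun _ _ h => imp_le_imp_right x h) k

theorem le_imp_iterate (x : A) (k : ℕ) (y : A) : y ≤ (x ⇾ ·)^[k] y := by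
  induction k with
  | zero => exact le_rfl
  | succ k ih => rw [Function.iterate_succ_apply']; exact le_trans ih (self_le_imp _ _)

theorem exchange_iterate (x y z : A) (k : ℕ) :
    (x ⇾ ·)^[k] (y ⇾ z) = y ⇾ (x ⇾ ·)^[k] z := by
  induction k with
  | zero => rfl
  | succ k ih => rw [Function.iterate_succ_apply', Function.iterate_succ_apply', ih, exchange]

/-- Proof by cases: `x ∨ y = 1` is `(x → y) → y = 1`. -/
theorem eq_one_of_join {x y z : A} (h : (x ⇾ y) ⇾ y = one) (hx : x ≤ z) (hy : y ≤ z) :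
    z = one := by
  have h' : (x ⇾ y) ⇾ y ≤ (z ⇾ y) ⇾ y := imp_le_imp_left (imp_le_imp_left hx y) y
  rw [h, one_le_iff, join_comm, le_iff.1 hy, one_imp] at h'
  exact h'

theorem eq_one_of_join_iterate {x y : A} (h : (x ⇾ y) ⇾ y = one) (k l : ℕ) {z : A}
    (hx : (x ⇾ ·)^[k] z = one) (hy : (y ⇾ ·)^[l] z = one) : z = one := by
  have step : ∀ (l : ℕ) (z : A), x ⇾ z = one → (y ⇾ ·)^[l] z = one → z = one := by
    intro l
    induction l with
    | zero => exact fun z _ hz => hz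
    | succ l ih =>
      intro z hxz hyz
      rw [Function.iterate_succ_apply] at hyz
      have h1 : y ⇾ z = one :=
        ih _ (one_le_iff.1 (hxz ▸ imp_le_imp_right x (self_le_imp y z))) hyz
      exact eq_one_of_join h hxz h1
  induction k generalizing z with
  | zero => exact hx
  | succ k ih =>
    rw [Function.iterate_succ_apply'] at hx
    exact ih (step l _ hx (one_le_iff.1 (hy ▸ imp_iterate_mono y l (le_imp_iterate x k z)))) hy

/-! ### Chains of bounded exponent -/

theorem join_eq_one_of_total (tot : ∀ x y : A, x ≤ y ∨ y ≤ x) {x y : A}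
    (h : (x ⇾ y) ⇾ y = one) : x = one ∨ y = one := by
  rcases tot x y with hxy | hxy
  · rw [le_iff.1 hxy, one_imp] at h
    exact Or.inr h
  · rw [join_comm, le_iff.1 hxy, one_imp] at h
    exact Or.inl h

/-- A chain of bounded exponent is simple: every `x < 1` is nilpotent. -/
theorem iterate_zero_eq_one (tot : ∀ x y : A, x ≤ y ∨ y ≤ x) {n : ℕ}
    (contr : ∀ x : A, (x ⇾ ·)^[n + 1] (zero : A) ≤ (x ⇾ ·)^[n] zero) {x : A} (hx : x ≠ one) :
    (x ⇾ ·)^[n] (zero : A) = one := by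
  have h := contr x
  rw [Function.iterate_succ_apply'] at h
  exact (join_eq_one_of_total tot (le_iff.1 h)).resolve_left hx

theorem iterate_eq_one_of_le {x y : A} {k l : ℕ} (hkl : k ≤ l) (h : (x ⇾ ·)^[k] y = one) :
    (x ⇾ ·)^[l] y = one := by
  obtain ⟨d, rfl⟩ := Nat.exists_eq_add_of_le' hkl
  rw [Function.iterate_add_apply, h]
  exact one_le_iff.1 (le_imp_iterate x d one)

/-- A chain of bounded exponent has a coatom, namely any `c < 1` of the greatest nilpotency index:
if `c < d < 1`, then the larger `y` of `d` and `d → c` is below `1` and satisfies `c ≤ y ⊗ y`,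
which makes its index greater. -/
theorem exists_coatom (tot : ∀ x y : A, x ≤ y ∨ y ≤ x) {n : ℕ}
    (contr : ∀ x : A, (x ⇾ ·)^[n + 1] (zero : A) ≤ (x ⇾ ·)^[n] zero) (h01 : (zero : A) ≠ one) :
    ∃ c : A, c ≠ one ∧ ∀ d : A, d ≠ one → d ≤ c := by
  classical
  let P : ℕ → Prop := fun K => ∃ x : A, x ≠ one ∧ (x ⇾ ·)^[K] (zero : A) ≠ one
  have hP0 : P 0 := ⟨zero, h01, h01⟩
  have hPn : ∀ K, P K → K ≤ n := by
    rintro K ⟨x, hx, hK⟩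
    by_contra hlt
    exact hK (iterate_eq_one_of_le (by omega) (iterate_zero_eq_one tot contr hx))
  obtain ⟨c, hc, hcK⟩ : P (Nat.findGreatest P n) := Nat.findGreatest_spec (Nat.zero_le n) hP0
  have hmax : ∀ K, P K → K ≤ Nat.findGreatest P n := fun K hK =>
    Nat.le_findGreatest (hPn K hK) hK
  generalize Nat.findGreatest P n = K at hcK hmax
  refine ⟨c, hc, fun d hd => (tot d c).elim id fun hcd => ?_⟩
  by_contra hdc
  have hw : d ⇾ c ≠ one := hdc
  obtain ⟨y, hy, hdy, hwy⟩ : ∃ y : A, y ≠ one ∧ d ≤ y ∧ d ⇾ c ≤ y := by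
    rcases tot d (d ⇾ c) with h | h
    exacts [⟨_, hw, h, le_rfl⟩, ⟨_, hd, le_rfl, h⟩]
  have hsq : ∀ v, y ⇾ y ⇾ v ≤ c ⇾ v := fun v => by
    calc y ⇾ y ⇾ v ≤ d ⇾ (d ⇾ c) ⇾ v :=
          le_trans (imp_le_imp_left hdy _) (imp_le_imp_right d (imp_le_imp_left hwy v))
      _ = c ⇾ v := by rw [← otimes_imp, otimes_imp_of_le hcd]
  have hpow : ∀ k, (y ⇾ ·)^[2 * k] (zero : A) ≤ (c ⇾ ·)^[k] zero := fun k => by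
    induction k with
    | zero => exact le_rfl
    | succ k ih =>
      rw [Nat.mul_succ, Function.iterate_succ_apply', Function.iterate_succ_apply',
        Function.iterate_succ_apply']
      exact le_trans (hsq _) (imp_le_imp_right c ih)
  rcases Nat.eq_zero_or_pos K with rfl | hK
  · have h1 : (d ⇾ ·)^[1] (zero : A) = one := by
      by_contra h
      exact absurd (hmax 1 ⟨d, hd, h⟩) (by omega)
    exact hdc (le_trans (le_iff.2 h1) (zero_le c))
  · have h2 : (y ⇾ ·)^[2 * K] (zero : A) = one := by
      by_contra h
      exact absurd (hmax _ ⟨y, hy, h⟩) (by omega)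
    exact hcK (one_le_iff.1 (h2 ▸ hpow K))

/-- A nontrivial chain of bounded exponent is a finite Łukasiewicz chain: with `c` the coatom, the
number `r x` of implications `c → ⋯` that lift `x` to `1` satisfies `r (x → y) = r y - r x`
(truncated), so that `x ↦ 1 - r x / m` is an embedding into the rational unit interval. -/
theorem exists_depth (tot : ∀ x y : A, x ≤ y ∨ y ≤ x) {n : ℕ}
    (contr : ∀ x : A, (x ⇾ ·)^[n + 1] (zero : A) ≤ (x ⇾ ·)^[n] zero) (h01 : (zero : A) ≠ one) :
    ∃ r : A → ℕ, 1 ≤ r zero ∧ r zero ≤ n ∧ (∀ x, r x ≤ r zero) ∧ (∀ x, r x = 0 ↔ x = one) ∧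
      (∀ x y, r (x ⇾ y) = r y - r x) ∧ (∀ x, r (neg x) = r zero - r x) ∧ ∃ c, r c = 1 := by
  obtain ⟨c, hc, hcoatom⟩ := exists_coatom tot contr h01
  have hnil : ∀ x, (c ⇾ ·)^[n] x = one := fun x =>
    one_le_iff.1 (iterate_zero_eq_one tot contr hc ▸ imp_iterate_mono c n (zero_le x))
  let r : A → ℕ := fun x => sInf {k | (c ⇾ ·)^[k] x = one}
  have hr : ∀ x, (c ⇾ ·)^[r x] x = one := fun x =>
    Nat.sInf_mem (s := {k | (c ⇾ ·)^[k] x = one}) ⟨n, hnil x⟩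
  have hle : ∀ x k, r x ≤ k ↔ (c ⇾ ·)^[k] x = one := fun x k =>
    ⟨fun h => iterate_eq_one_of_le h (hr x), fun h => Nat.sInf_le h⟩
  have hr0 : ∀ x, r x = 0 ↔ x = one := fun x => by rw [← Nat.le_zero, hle]; rfl
  -- implications from `c` may be cancelled as long as the antecedent has not reached `1`
  have hcancel : ∀ x y k, k ≤ r x → (c ⇾ ·)^[k] x ⇾ (c ⇾ ·)^[k] y = x ⇾ y := by
    intro x y k
    induction k with
    | zero => exact fun _ => rfl
    | succ k ih =>
      intro hk
      rw [Function.iterate_succ_apply', Function.iterate_succ_apply', imp_imp_imp_cancel,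
        ih (by omega)]
      exact hcoatom _ fun h => absurd ((hle x k).2 h) (by omega)
  have himp : ∀ x y, r (x ⇾ y) = r y - r x := by
    intro x y
    refine eq_of_forall_ge_iff fun k => ?_
    rw [← hcancel x y _ le_rfl, hr, one_imp, hle, ← Function.iterate_add_apply, ← hle]
    omega
  have hz : ∀ x, r x ≤ r zero := fun x =>
    (hle x _).2 (one_le_iff.1 (hr zero ▸ imp_iterate_mono c _ (zero_le x)))
  refine ⟨r, ?_, (hle _ _).2 (hnil _), hz, hr0, himp, fun x => by rw [neg_eq, himp], c, ?_⟩
  · exact Nat.one_le_iff_ne_zero.2 fun h => h01 ((hr0 _).1 h)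
  · have h1 : r c ≤ 1 := (hle _ _).2 (imp_self c)
    have h2 : r c ≠ 0 := fun h => hc ((hr0 _).1 h)
    omega

end WajsbergAlgebra

open Fm

/-! ### Evaluations in the unit interval -/

/-- The extension of a rational assignment by the Łukasiewicz operations. Every chain `LV n` is
closed under them, so that one evaluation serves all chains. -/
def val (e : ℕ → ℚ) : Fm → ℚ
  | .var k => e k
  | .neg a => 1 - val e a
  | .imp a b => min 1 (1 - val e a + val e b)

theorem val_subst (e : ℕ → ℚ) (s : ℕ → Fm) (a : Fm) :
    val e (a.subst s) = val (fun k => val e (s k)) a := by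
  induction a with
  | var k => rfl
  | neg a ih => simp only [Fm.subst, val, ih]
  | imp a b iha ihb => simp only [Fm.subst, val, iha, ihb]

theorem val_mem_LV {n : ℕ} [NeZero n] {e : ℕ → ℚ} (he : ∀ k, e k ∈ LV n) (a : Fm) :
    val e a ∈ LV n := by
  induction a with
  | var k => exact he k
  | neg a ih => exact neg_mem_LV n ih
  | imp a b iha ihb => exact imp_mem_LV n iha ihb

theorem mem_Icc_of_mem_LV {n : ℕ} {x : ℚ} (hx : x ∈ LV n) : x ∈ Set.Icc (0 : ℚ) 1 := by
  obtain ⟨k, hk, rfl⟩ := hx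
  exact ⟨by positivity, div_le_one_of_le₀ (by exact_mod_cast hk) (by positivity)⟩

theorem zero_mem_LV (n : ℕ) : (0 : ℚ) ∈ LV n := ⟨0, Nat.zero_le n, by simp⟩

theorem one_mem_LV (n : ℕ) [NeZero n] : (1 : ℚ) ∈ LV n :=
  ⟨n, le_rfl, (div_self (Nat.cast_ne_zero.2 (NeZero.ne n))).symm⟩

theorem mem_LV_one_iff {x : ℚ} : x ∈ LV 1 ↔ x = 0 ∨ x = 1 := by
  constructor
  · rintro ⟨k, hk, rfl⟩
    interval_cases k <;> simp
  · rintro (rfl | rfl)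
    exacts [zero_mem_LV 1, one_mem_LV 1]

theorem LV_subset_of_dvd {m n : ℕ} [NeZero n] (h : m ∣ n) : LV m ⊆ LV n := by
  rintro x ⟨k, hk, rfl⟩
  obtain ⟨d, rfl⟩ := h
  have hd : d ≠ 0 := fun hd => NeZero.ne (m * d) (by simp [hd])
  refine ⟨k * d, Nat.mul_le_mul_right d hk, ?_⟩
  push_cast
  rw [mul_div_mul_right _ _ (Nat.cast_ne_zero.2 hd)]

theorem eq_one_or_le_of_mem_LV {n : ℕ} [NeZero n] {x : ℚ} (hx : x ∈ LV n) :
    x = 1 ∨ x ≤ 1 - 1 / n := by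
  obtain ⟨k, hk, rfl⟩ := hx
  have hn : (0 : ℚ) < n := Nat.cast_pos.2 (NeZero.pos n)
  rcases hk.eq_or_lt with rfl | hk
  · exact Or.inl (div_self hn.ne')
  · right
    have : (k : ℚ) + 1 ≤ n := by exact_mod_cast hk
    rw [div_le_iff₀ hn, sub_mul, div_mul_cancel₀ _ hn.ne']
    linarith

section Val

variable {e : ℕ → ℚ}

theorem val_mem_Icc (he : ∀ k, e k ∈ Set.Icc (0 : ℚ) 1) (a : Fm) :
    val e a ∈ Set.Icc (0 : ℚ) 1 := by
  induction a with
  | var k => exact he k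
  | neg a ih => exact ⟨by simpa [val] using ih.2, by simpa [val] using ih.1⟩
  | imp a b iha ihb =>
    exact ⟨le_min zero_le_one (by linarith [iha.2, ihb.1]), min_le_left _ _⟩

theorem val_imp_eq_one (a b : Fm) : val e (imp a b) = 1 ↔ val e a ≤ val e b := by
  rw [val, min_eq_left_iff]
  constructor <;> intro h <;> linarith

theorem val_falsum (a : Fm) : val e (falsum a) = 0 := by
  have := (val_imp_eq_one (e := e) a a).2 le_rfl
  rw [falsum, val, this, sub_self]

theorem val_oplus (a b : Fm) : val e (oplus a b) = min 1 (val e a + val e b) := by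
  simp only [oplus, val]
  congr 1
  ring

theorem val_otimes (a b : Fm) : val e (otimes a b) = max 0 (val e a + val e b - 1) := by
  simp only [otimes, val]
  rw [← max_sub_sub_left]
  congr 1 <;> ring

theorem val_conj (he : ∀ k, e k ∈ Set.Icc (0 : ℚ) 1) (a b : Fm) :
    val e (conj a b) = min (val e a) (val e b) := by
  obtain ⟨ha, ha'⟩ := val_mem_Icc he a
  obtain ⟨hb, hb'⟩ := val_mem_Icc he b
  simp only [conj, val]
  grind

theorem val_nmul (he : ∀ k, e k ∈ Set.Icc (0 : ℚ) 1) (i : ℕ) (a : Fm) :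
    val e (nmul i a) = min 1 (i * val e a) := by
  have ha := val_mem_Icc he a
  induction i, a using nmul.induct with
  | case1 a => simp [nmul, val_falsum]
  | case2 a => simp [nmul, ha.2]
  | case3 i a ih =>
    rw [nmul, val_oplus, ih ha]
    push_cast
    rcases le_total 1 ((i + 1 : ℚ) * val e a) with h | h
    · rw [min_eq_left h, min_eq_left, min_eq_left] <;> linarith [ha.1]
    · rw [min_eq_right h]
      congr 1
      ring

theorem val_npow (he : ∀ k, e k ∈ Set.Icc (0 : ℚ) 1) (i : ℕ) (a : Fm) :
    val e (npow i a) = max 0 (1 - i * (1 - val e a)) := by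
  have ha := val_mem_Icc he a
  induction i, a using npow.induct with
  | case1 a => simp [npow, val]
  | case2 a => simp [npow, ha.1]
  | case3 i a ih =>
    rw [npow, val_otimes, ih ha]
    push_cast
    rcases le_total 0 (1 - (i + 1 : ℚ) * (1 - val e a)) with h | h
    · rw [max_eq_right h]
      congr 1
      ring
    · rw [max_eq_left h, max_eq_left, max_eq_left] <;> linarith [ha.2]

theorem val_lin (he : ∀ k, e k ∈ Set.Icc (0 : ℚ) 1) (N K : ℕ) (a : Fm) :
    val e (lin N K a) = min 1 (max 0 (N * val e a - K)) := by
  have ha := val_mem_Icc he a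
  induction N, K, a using lin.induct with
  | case1 K a => simp [lin, val_falsum]
  | case2 N a ih =>
    rw [lin, val_oplus, ih ha]
    push_cast
    have : 0 ≤ (N : ℚ) * val e a := mul_nonneg (Nat.cast_nonneg N) ha.1
    grind
  | case3 N K a ih₁ ih₂ =>
    rw [lin, val_otimes, val_oplus, ih₁ ha, ih₂ ha]
    push_cast
    generalize hu : (N : ℚ) * val e a - K = u
    rw [show (N : ℚ) * val e a - (K + 1) = u - 1 by linarith,
      show ((N : ℚ) + 1) * val e a - (K + 1) = u - 1 + val e a by linarith]
    grind

end Val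

/-! ### Entailment in terms of rational evaluations -/

theorem coe_eval_chainMatrix {i n : ℕ} [NeZero n] (e : ℕ → (chainMatrix i n).Carrier) (a : Fm) :
    (show LV n from (chainMatrix i n).eval e a).1 = val (fun k => (show LV n from e k).1) a := by
  induction a with
  | var k => rfl
  | neg a ih => simp only [val, ← ih]; rfl
  | imp a b iha ihb => simp only [val, ← iha, ← ihb]; rfl

theorem eval_mem_des_iff {i n : ℕ} [NeZero n] (e : ℕ → (chainMatrix i n).Carrier) (a : Fm) :
    (chainMatrix i n).eval e a ∈ (chainMatrix i n).des ↔
      (i / n : ℚ) ≤ val (fun k => (show LV n from e k).1) a := by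
  rw [← coe_eval_chainMatrix]
  rfl

theorem eval_mem_des_self_iff {n : ℕ} [NeZero n] (e : ℕ → (chainMatrix n n).Carrier) (a : Fm) :
    (chainMatrix n n).eval e a ∈ (chainMatrix n n).des ↔
      val (fun k => (show LV n from e k).1) a = 1 := by
  rw [eval_mem_des_iff, div_self (Nat.cast_ne_zero.2 (NeZero.ne n))]
  exact ⟨fun h => le_antisymm
    (mem_Icc_of_mem_LV (val_mem_LV (fun k => (show LV n from e k).2) a)).2 h, fun h => h.ge⟩

theorem lukLogic_entails_iff {i n : ℕ} [NeZero n] {Γ : Set Fm} {φ : Fm} :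
    (lukLogic i n).entails Γ φ ↔ ∀ e : ℕ → ℚ, (∀ k, e k ∈ LV n) →
      (∀ ψ ∈ Γ, (i / n : ℚ) ≤ val e ψ) → (i / n : ℚ) ≤ val e φ := by
  constructor
  · intro h e he hΓ
    exact (eval_mem_des_iff (fun k => ⟨e k, he k⟩) φ).1
      (h _ fun ψ hψ => (eval_mem_des_iff _ ψ).2 (hΓ ψ hψ))
  · intro h e hΓ
    exact (eval_mem_des_iff e φ).2 (h _ (fun k => (show LV n from e k).2)
      fun ψ hψ => (eval_mem_des_iff _ ψ).1 (hΓ ψ hψ))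

theorem lukLogic_self_entails_iff {n : ℕ} [NeZero n] {Γ : Set Fm} {φ : Fm} :
    (lukLogic n n).entails Γ φ ↔ ∀ e : ℕ → ℚ, (∀ k, e k ∈ LV n) →
      (∀ ψ ∈ Γ, val e ψ = 1) → val e φ = 1 := by
  constructor
  · intro h e he hΓ
    exact (eval_mem_des_self_iff (fun k => ⟨e k, he k⟩) φ).1
      (h _ fun ψ hψ => (eval_mem_des_self_iff _ ψ).2 (hΓ ψ hψ))
  · intro h e hΓ
    exact (eval_mem_des_self_iff e φ).2 (h _ (fun k => (show LV n from e k).2)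
      fun ψ hψ => (eval_mem_des_self_iff _ ψ).1 (hΓ ψ hψ))

theorem CPL_entails_iff {Γ : Set Fm} {φ : Fm} :
    CPL.entails Γ φ ↔ ∀ e : ℕ → ℚ, (∀ k, e k ∈ LV 1) → (∀ ψ ∈ Γ, val e ψ = 1) → val e φ = 1 :=
  lukLogic_self_entails_iff

theorem eval_prod (M N : LMatrix) (e : ℕ → (M.prod N).Carrier) (a : Fm) :
    (M.prod N).eval e a = (M.eval (fun k => (e k).1) a, N.eval (fun k => (e k).2) a) := by
  induction a with
  | var k => rfl
  | neg a ih => simp only [LMatrix.eval, ih]; rfl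
  | imp a b iha ihb => simp only [LMatrix.eval, iha, ihb]; rfl

theorem prod_logic_entails_iff {M N : LMatrix} {Γ : Set Fm} {φ : Fm} :
    (M.prod N).logic.entails Γ φ ↔ ∀ (e₁ : ℕ → M.Carrier) (e₂ : ℕ → N.Carrier),
      (∀ ψ ∈ Γ, M.eval e₁ ψ ∈ M.des) → (∀ ψ ∈ Γ, N.eval e₂ ψ ∈ N.des) →
        M.eval e₁ φ ∈ M.des ∧ N.eval e₂ φ ∈ N.des := by
  have hdes : ∀ e a, (M.prod N).eval e a ∈ (M.prod N).des ↔
      M.eval (fun k => (e k).1) a ∈ M.des ∧ N.eval (fun k => (e k).2) a ∈ N.des := fun e a => by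
    rw [eval_prod]; rfl
  constructor
  · intro h e₁ e₂ h₁ h₂
    exact (hdes (fun k => (e₁ k, e₂ k)) φ).1
      (h _ fun ψ hψ => (hdes _ ψ).2 ⟨h₁ ψ hψ, h₂ ψ hψ⟩)
  · intro h e he
    exact (hdes e φ).2 (h _ _ (fun ψ hψ => ((hdes e ψ).1 (he ψ hψ)).1)
      fun ψ hψ => ((hdes e ψ).1 (he ψ hψ)).2)

/-! ### Derivations in Hilbert calculi -/

theorem subst_nmul (s : ℕ → Fm) (i : ℕ) (a : Fm) : (nmul i a).subst s = nmul i (a.subst s) := by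
  induction i, a using nmul.induct with
  | case1 a => rfl
  | case2 a => rfl
  | case3 i a ih => simp only [nmul, oplus, Fm.subst, ih]

theorem subst_npow (s : ℕ → Fm) (i : ℕ) (a : Fm) : (npow i a).subst s = npow i (a.subst s) := by
  induction i, a using npow.induct with
  | case1 a => rfl
  | case2 a => rfl
  | case3 i a ih => simp only [npow, otimes, Fm.subst, ih]

theorem subst_lin (s : ℕ → Fm) (N K : ℕ) (a : Fm) :
    (lin N K a).subst s = lin N K (a.subst s) := by
  induction N, K, a using lin.induct with
  | case1 K a => rfl
  | case2 N a ih => simp only [lin, oplus, Fm.subst, ih]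
  | case3 N K a ih₁ ih₂ => simp only [lin, otimes, oplus, Fm.subst, ih₁, ih₂]

theorem subst_subst (s t : ℕ → Fm) (a : Fm) :
    (a.subst s).subst t = a.subst (fun k => (s k).subst t) := by
  induction a with
  | var k => rfl
  | neg a ih => simp only [Fm.subst, ih]
  | imp a b iha ihb => simp only [Fm.subst, iha, ihb]

theorem subst_var (a : Fm) : a.subst var = a := by
  induction a with
  | var k => rfl
  | neg a ih => simp only [Fm.subst, ih]
  | imp a b iha ihb => simp only [Fm.subst, iha, ihb]

namespace HilbertCalculus

variable {H : HilbertCalculus} {Γ Δ : Set Fm} {φ : Fm}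

theorem Derives.cut (h : ∀ ψ ∈ Δ, H.Derives Γ ψ) (hφ : H.Derives Δ φ) : H.Derives Γ φ := by
  induction hφ with
  | hyp φ hφ => exact h φ hφ
  | rule r s hr _ ih => exact .rule r s hr ih

theorem Derives.mono (h : Δ ⊆ Γ) (hφ : H.Derives Δ φ) : H.Derives Γ φ :=
  hφ.cut fun ψ hψ => .hyp ψ (h hψ)

theorem Derives.subst (hφ : H.Derives Γ φ) (s : ℕ → Fm) :
    H.Derives (Fm.subst s '' Γ) (φ.subst s) := by
  induction hφ with
  | hyp φ hφ => exact .hyp _ ⟨φ, hφ, rfl⟩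
  | rule r t hr _ ih =>
    rw [subst_subst]
    exact .rule r _ hr fun ψ hψ => by rw [← subst_subst]; exact ih ψ hψ

theorem Derives.exists_finite (hφ : H.Derives Γ φ) : ∃ Δ ⊆ Γ, Δ.Finite ∧ H.Derives Δ φ := by
  induction hφ with
  | hyp φ hφ =>
    exact ⟨{φ}, Set.singleton_subset_iff.2 hφ, Set.finite_singleton φ, .hyp φ rfl⟩
  | rule r s hr _ ih =>
    choose! F hF hfin hder using ih
    refine ⟨⋃ ψ ∈ {ψ | ψ ∈ r.prems}, F ψ, Set.iUnion₂_subset hF,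
      (List.finite_toSet r.prems).biUnion hfin, .rule r s hr fun ψ hψ => ?_⟩
    exact (hder ψ hψ).mono (Set.subset_biUnion_of_mem (u := F) hψ)

/-- The logic of a Hilbert calculus. -/
def logic (H : HilbertCalculus) : PropLogic where
  entails := H.Derives
  refl _ φ h := .hyp φ h
  cut _ _ _ h₁ h₂ := h₂.cut h₁
  structural s _ _ h := h.subst s

theorem logic_validates {r : FRule} (hr : r ∈ H) : H.logic.Validates r := by
  have h : H.Derives {φ | φ ∈ r.prems} (r.concl.subst var) :=
    .rule r var hr fun ψ hψ => by rw [subst_var]; exact .hyp ψ hψ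
  rwa [subst_var] at h

theorem soundComplete_iff {L : PropLogic} : H.SoundComplete L ↔ H.logic = L := by
  constructor
  · intro h
    ext Γ φ
    exact h Γ φ
  · rintro rfl Γ φ
    exact Iff.rfl

/-- A calculus is sound for every logic that validates its rules. -/
theorem logic_le_of_validates {L : PropLogic} (h : ∀ r ∈ H, L.Validates r) : H.logic ≤ L := by
  rw [PropLogic.le_iff]
  intro Γ φ hφ
  induction hφ with
  | hyp φ hφ => exact L.refl _ _ hφ
  | rule r s hr _ ih =>
    refine L.cut _ _ _ ?_ (L.structural s _ _ (h r hr))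
    rintro _ ⟨ψ, hψ, rfl⟩
    exact ih ψ hψ

theorem logic_mono {H' : HilbertCalculus} (h : H ⊆ H') : H.logic ≤ H'.logic :=
  logic_le_of_validates fun _ hr => logic_validates (h hr)

/-- Lindenbaum's lemma. -/
theorem exists_maximal_not_derives (h : ¬ H.Derives Γ φ) :
    ∃ T, Γ ⊆ T ∧ Maximal (fun Δ => ¬ H.Derives Δ φ) T := by
  refine zorn_subset_nonempty {Δ | ¬ H.Derives Δ φ} ?_ Γ h
  intro c hc hchain hne
  refine ⟨⋃₀ c, fun hder => ?_, fun s hs => Set.subset_sUnion_of_mem hs⟩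
  obtain ⟨Δ, hΔ, hfin, hder⟩ := hder.exists_finite
  obtain ⟨s, hs, hΔs⟩ :=
    DirectedOn.exists_mem_subset_of_finite_of_subset_sUnion hne hchain.directedOn hfin hΔ
  exact hc hs (hder.mono hΔs)

end HilbertCalculus

/-! ### Lindenbaum algebras of Łukasiewicz theories -/

/-- A set of formulas that contains all instances of the axioms of the `(n+1)`-valued Łukasiewicz
logic and is closed under modus ponens. -/
structure LukTheory (n : ℕ) where
  carrier : Set Fm
  ax : ∀ a, LukAxiom n a → ∀ s : ℕ → Fm, a.subst s ∈ carrier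
  mp : ∀ a b, a ∈ carrier → imp a b ∈ carrier → b ∈ carrier

namespace LukTheory

variable {n : ℕ} (T : LukTheory n)

/-- The assignment of three formulas to the first three variables. -/
def inst (a b c : Fm) : ℕ → Fm
  | 0 => a
  | 1 => b
  | _ => c

theorem weakening (a b : Fm) : imp a (imp b a) ∈ T.carrier :=
  T.ax _ .weakening (inst a b a)

theorem transitivity (a b c : Fm) :
    imp (imp a b) (imp (imp b c) (imp a c)) ∈ T.carrier :=
  T.ax _ .transitivity (inst a b c)

theorem join_comm (a b : Fm) : imp (imp (imp a b) b) (imp (imp b a) a) ∈ T.carrier :=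
  T.ax _ .join_comm (inst a b a)

theorem contraposition (a b : Fm) : imp (imp (neg a) (neg b)) (imp b a) ∈ T.carrier :=
  T.ax _ .contraposition (inst a b a)

theorem linearity (a b : Fm) : imp (imp (imp a b) (imp b a)) (imp b a) ∈ T.carrier :=
  T.ax _ .linearity (inst a b a)

variable {T}

theorem imp_trans {a b c : Fm} (h₁ : imp a b ∈ T.carrier) (h₂ : imp b c ∈ T.carrier) :
    imp a c ∈ T.carrier :=
  T.mp _ _ h₂ (T.mp _ _ h₁ (T.transitivity a b c))

theorem imp_of_mem {b : Fm} (a : Fm) (h : b ∈ T.carrier) : imp a b ∈ T.carrier :=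
  T.mp _ _ h (T.weakening b a)

theorem imp_imp_self (a b : Fm) : imp a (imp (imp a b) b) ∈ T.carrier :=
  imp_trans (T.weakening a (imp b a)) (T.join_comm b a)

theorem imp_refl (a : Fm) : imp a a ∈ T.carrier := by
  have h := T.weakening a a
  exact imp_trans (T.weakening a _) (T.mp _ _ h (imp_imp_self _ a))

theorem imp_left {a b : Fm} (h : imp a b ∈ T.carrier) (c : Fm) :
    imp (imp b c) (imp a c) ∈ T.carrier :=
  T.mp _ _ h (T.transitivity a b c)

theorem exchange (a b c : Fm) : imp (imp a (imp b c)) (imp b (imp a c)) ∈ T.carrier :=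
  imp_trans (T.transitivity a (imp b c) c) (imp_left (imp_imp_self b c) _)

theorem imp_right {b c : Fm} (h : imp b c ∈ T.carrier) (a : Fm) :
    imp (imp a b) (imp a c) ∈ T.carrier :=
  T.mp _ _ h (T.mp _ _ (T.transitivity a b c) (exchange _ _ _))

theorem neg_neg_imp (a : Fm) : imp (neg (neg a)) a ∈ T.carrier := by
  have h : imp (neg (neg a)) (imp (neg a) (neg (imp a a))) ∈ T.carrier :=
    imp_trans (T.weakening _ (neg (neg (imp a a)))) (T.contraposition _ _)
  exact imp_trans (imp_trans h (T.contraposition _ _)) (T.mp _ _ (imp_refl a) (imp_imp_self _ _))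

theorem neg_imp_neg {a b : Fm} (h : imp a b ∈ T.carrier) : imp (neg b) (neg a) ∈ T.carrier :=
  T.mp _ _ (imp_trans (imp_trans (neg_neg_imp a) h)
    (T.mp _ _ (neg_neg_imp (neg b)) (T.contraposition _ _))) (T.contraposition _ _)

variable (T)

/-- Provable equivalence over `T`. -/
def setoid : Setoid Fm where
  r a b := imp a b ∈ T.carrier ∧ imp b a ∈ T.carrier
  iseqv := ⟨fun a => ⟨imp_refl a, imp_refl a⟩, fun h => ⟨h.2, h.1⟩,
    fun h₁ h₂ => ⟨imp_trans h₁.1 h₂.1, imp_trans h₂.2 h₁.2⟩⟩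

/-- The Lindenbaum algebra of `T`. -/
def Alg : Type := Quotient T.setoid

/-- The class of a formula in the Lindenbaum algebra. -/
def cls (a : Fm) : T.Alg := Quotient.mk T.setoid a

theorem cls_eq_cls_iff {a b : Fm} :
    T.cls a = T.cls b ↔ imp a b ∈ T.carrier ∧ imp b a ∈ T.carrier :=
  Quotient.eq (r := T.setoid)

theorem cls_eq_cls_top_iff {a b : Fm} : T.cls a = T.cls (imp b b) ↔ a ∈ T.carrier := by
  rw [cls_eq_cls_iff]
  exact ⟨fun h => T.mp _ _ (imp_refl b) h.2, fun h => ⟨imp_of_mem a (imp_refl b), imp_of_mem _ h⟩⟩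

instance : WajsbergAlgebra T.Alg where
  imp := Quotient.map₂ imp fun _ _ h₁ _ _ h₂ =>
    ⟨imp_trans (imp_left h₁.2 _) (imp_right h₂.1 _), imp_trans (imp_left h₁.1 _) (imp_right h₂.2 _)⟩
  neg := Quotient.map neg fun _ _ h => ⟨neg_imp_neg h.2, neg_imp_neg h.1⟩
  one := T.cls (imp (var 0) (var 0))
  weakening := by
    rintro ⟨a⟩ ⟨b⟩
    exact T.cls_eq_cls_top_iff.2 (T.weakening a b)
  transitivity := by
    rintro ⟨a⟩ ⟨b⟩ ⟨c⟩
    exact T.cls_eq_cls_top_iff.2 (T.transitivity a b c)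
  join_comm := by
    rintro ⟨a⟩ ⟨b⟩
    exact T.cls_eq_cls_iff.2 ⟨T.join_comm a b, T.join_comm b a⟩
  contraposition := by
    rintro ⟨a⟩ ⟨b⟩
    exact T.cls_eq_cls_top_iff.2 (T.contraposition a b)
  antisymm := by
    rintro ⟨a⟩ ⟨b⟩ h₁ h₂
    exact T.cls_eq_cls_iff.2 ⟨T.cls_eq_cls_top_iff.1 h₁, T.cls_eq_cls_top_iff.1 h₂⟩
  mp := by
    rintro ⟨a⟩ h
    exact T.cls_eq_cls_top_iff.2 (T.mp _ _ (imp_refl _) (T.cls_eq_cls_top_iff.1 h))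

open WajsbergAlgebra

local infixr:60 " ⇾ " => WajsbergAlgebra.imp

theorem cls_imp (a b : Fm) : T.cls (imp a b) = T.cls a ⇾ T.cls b := rfl

theorem cls_neg (a : Fm) : T.cls (neg a) = WajsbergAlgebra.neg (T.cls a) := rfl

theorem cls_eq_one_iff {a : Fm} : T.cls a = one ↔ a ∈ T.carrier := T.cls_eq_cls_top_iff

theorem cls_surjective (x : T.Alg) : ∃ a, T.cls a = x := Quotient.exists_rep x

/-- The power `aᵏ` residuates to the `k`-fold implication from `a`. -/
theorem cls_npow_imp (k : ℕ) (a : Fm) (x : T.Alg) :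
    T.cls (npow k a) ⇾ x = (T.cls a ⇾ ·)^[k] x := by
  induction k, a using npow.induct generalizing x with
  | case1 a =>
    rw [npow, T.cls_eq_one_iff.2 (imp_refl a), one_imp]
    rfl
  | case2 a => rfl
  | case3 k a ih =>
    rw [npow, otimes, cls_neg, cls_imp, cls_neg, otimes_imp, ih, ← Function.iterate_succ_apply]

theorem iterate_succ_imp_le (x y : T.Alg) : (x ⇾ ·)^[n + 1] y ≤ (x ⇾ ·)^[n] y := by
  obtain ⟨a, rfl⟩ := T.cls_surjective x
  rw [← cls_npow_imp, ← cls_npow_imp]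
  have h := T.ax _ .contraction (fun _ => a)
  rw [Fm.subst, subst_npow, subst_npow, Fm.subst] at h
  exact imp_le_imp_left (T.cls_eq_one_iff.2 h) _

/-- The local deduction theorem. -/
theorem exists_iterate_of_derives {a b : Fm}
    (h : (lukCalculus n).Derives (insert a T.carrier) b) :
    ∃ k, (T.cls a ⇾ ·)^[k] (T.cls b) = one := by
  induction h with
  | hyp b hb =>
    rcases hb with rfl | hb
    · exact ⟨1, imp_self _⟩
    · exact ⟨0, T.cls_eq_one_iff.2 hb⟩
  | rule r s hr _ ih =>
    rcases hr with ⟨_, hax⟩ | rfl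
    · exact ⟨0, T.cls_eq_one_iff.2 (T.ax _ hax s)⟩
    · obtain ⟨k, hk⟩ := ih (var 0) (by simp)
      obtain ⟨l, hl⟩ := ih (imp (var 0) (var 1)) (by simp)
      refine ⟨k + l, ?_⟩
      rw [Fm.subst, cls_imp, exchange_iterate] at hl
      rw [Function.iterate_add_apply]
      exact one_le_iff.1 (hk ▸ imp_iterate_mono (T.cls a) k hl)

/-- A maximal set of formulas from which `φ` is not derivable is a theory. -/
def ofMaximal {φ : Fm} {Δ : Set Fm}
    (h : Maximal (fun Δ => ¬ (lukCalculus n).Derives Δ φ) Δ) : LukTheory n :=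
  have key : ∀ a, (lukCalculus n).Derives Δ a → a ∈ Δ := fun a ha =>
    h.le_of_ge (y := insert a Δ)
      (fun hd => h.prop (hd.cut (by
        rintro ψ (rfl | hψ)
        exacts [ha, .hyp ψ hψ])))
      (Set.subset_insert a Δ) (Set.mem_insert a Δ)
  { carrier := Δ
    ax := fun a ha s => key _ (.rule ⟨[], a⟩ s (Or.inl ⟨rfl, ha⟩) (by simp))
    mp := fun a b ha hab => key _ (.rule ⟨[var 0, imp (var 0) (var 1)], var 1⟩ (inst a b b)
      (Or.inr rfl) (by
        intro ψ hψ
        simp only [List.mem_cons, List.not_mem_nil, or_false] at hψ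
        rcases hψ with rfl | rfl
        exacts [.hyp _ ha, .hyp _ hab])) }

/-- If neither `a → b` nor `b → a` belonged to a maximal set, then `φ` would be derivable from each
of them, and hence by the linearity axiom outright. -/
theorem total_of_maximal {φ : Fm}
    (h : Maximal (fun Δ => ¬ (lukCalculus n).Derives Δ φ) T.carrier) (x y : T.Alg) :
    x ≤ y ∨ y ≤ x := by
  obtain ⟨a, rfl⟩ := T.cls_surjective x
  obtain ⟨b, rfl⟩ := T.cls_surjective y
  by_contra! hcon
  have key : ∀ c, T.cls c ≠ one → ∃ k, (T.cls c ⇾ ·)^[k] (T.cls φ) = one := fun c hc => by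
    refine T.exists_iterate_of_derives ?_
    by_contra hd
    exact hc (T.cls_eq_one_iff.2 (h.le_of_ge (y := insert c T.carrier) hd
      (Set.subset_insert c _) (Set.mem_insert c _)))
  obtain ⟨k, hk⟩ := key (imp a b) hcon.1
  obtain ⟨l, hl⟩ := key (imp b a) hcon.2
  have h1 := eq_one_of_join_iterate (T.cls_eq_one_iff.2 (T.linearity a b)) k l hk hl
  exact h.prop (.hyp φ (T.cls_eq_one_iff.1 h1))

/-- The divisor axioms force the length of a Łukasiewicz chain to divide `n`: with `m ∤ n`, the
axiom for `h = m` fails at `1 - 1/m`, where `h xʰ⁻¹ = 1` and `xʰ = 0`. -/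
theorem dvd_of_val_eq {m : ℕ} (hm : 1 ≤ m) (hmn : m ≤ n) {e : ℕ → ℚ}
    (he : ∀ k, e k ∈ Set.Icc (0 : ℚ) 1) (hT : ∀ a ∈ T.carrier, val e a = 1)
    {c : Fm} (hc : val e c = 1 - 1 / m) : m ∣ n := by
  by_contra hdvd
  have h2 : 2 ≤ m := by
    rcases hm.eq_or_lt with rfl | h
    exacts [absurd (one_dvd n) hdvd, h]
  have hlt : m < n := lt_of_le_of_ne hmn fun h => hdvd (h ▸ dvd_rfl)
  have hax := hT _ (T.ax _ (.divisor_conv m h2 hlt hdvd) (fun _ => c))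
  rw [Fm.subst, subst_npow, subst_nmul, subst_npow, subst_nmul, subst_npow, Fm.subst,
    val_imp_eq_one] at hax
  have hm0 : (m : ℚ) ≠ 0 := by positivity
  have e1 : val e (npow (m - 1) c) = 1 / m := by
    rw [val_npow he, hc, Nat.cast_sub hm, Nat.cast_one]
    rw [show (1 : ℚ) - (m - 1) * (1 - (1 - 1 / m)) = 1 / m by field_simp; ring]
    exact max_eq_right (by positivity)
  have e2 : val e (npow m c) = 0 := by
    rw [val_npow he, hc, show (1 : ℚ) - m * (1 - (1 - 1 / m)) = 0 by field_simp; ring, max_self]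
  have e3 : val e (nmul m (npow (m - 1) c)) = 1 := by
    rw [val_nmul he, e1, mul_one_div_cancel hm0, min_self]
  rw [val_npow he (n + 1), e3, val_nmul he, e2] at hax
  norm_num at hax

/-- A consistent theory with linearly ordered Lindenbaum algebra is the set of formulas true under
an evaluation in the `(n+1)`-element chain. -/
theorem exists_evaluation [NeZero n] (tot : ∀ x y : T.Alg, x ≤ y ∨ y ≤ x) {φ : Fm}
    (hφ : φ ∉ T.carrier) :
    ∃ e : ℕ → ℚ, (∀ k, e k ∈ LV n) ∧ ∀ a, val e a = 1 ↔ a ∈ T.carrier := by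
  have h01 : (zero : T.Alg) ≠ one := fun h =>
    hφ (T.cls_eq_one_iff.1 (one_le_iff.1 (h ▸ zero_le (T.cls φ))))
  obtain ⟨r, hm, hmn, hle, hr0, himp, hneg, x, hx⟩ :=
    exists_depth tot (fun x => T.iterate_succ_imp_le x zero) h01
  generalize r (zero : T.Alg) = m at hm hmn hle hneg
  have hm0 : (0 : ℚ) < m := by exact_mod_cast hm
  let e : ℕ → ℚ := fun k => 1 - r (T.cls (var k)) / m
  have he : ∀ a, val e a = 1 - r (T.cls a) / m := by
    intro a
    induction a with
    | var k => rfl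
    | neg a ih =>
      rw [val, ih, cls_neg, hneg, Nat.cast_sub (hle _)]
      field_simp
    | imp a b iha ihb =>
      rw [val, iha, ihb, cls_imp, himp]
      rcases le_total (r (T.cls b)) (r (T.cls a)) with h | h
      · have h' : (r (T.cls b) : ℚ) / m ≤ r (T.cls a) / m := by gcongr
        rw [Nat.sub_eq_zero_of_le h, Nat.cast_zero, zero_div, sub_zero, min_eq_left]
        linarith
      · have h' : (r (T.cls a) : ℚ) / m ≤ r (T.cls b) / m := by gcongr
        rw [Nat.cast_sub h, sub_div, min_eq_right (by linarith)]
        ring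
  have hval : ∀ a, val e a = 1 ↔ a ∈ T.carrier := fun a => by
    rw [he, sub_eq_self, div_eq_zero_iff, Nat.cast_eq_zero, or_iff_left hm0.ne', hr0,
      cls_eq_one_iff]
  have hLV : ∀ k, e k ∈ LV m := fun k => by
    refine ⟨m - r (T.cls (var k)), Nat.sub_le _ _, ?_⟩
    rw [Nat.cast_sub (hle _)]
    simp only [e]
    field_simp
  obtain ⟨c, rfl⟩ := T.cls_surjective x
  have hdvd : m ∣ n := T.dvd_of_val_eq hm hmn (fun k => mem_Icc_of_mem_LV (hLV k))
    (fun a ha => (hval a).2 ha) (c := c) (by rw [he, hx, Nat.cast_one])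
  exact ⟨e, fun k => LV_subset_of_dvd hdvd (hLV k), hval⟩

end LukTheory

/-! ### Soundness and completeness of the calculi for the chains -/

section Axioms

variable {n : ℕ} [NeZero n] {e : ℕ → ℚ}

theorem val_eq_one_of_lukAxiom (he : ∀ k, e k ∈ LV n) {a : Fm} (ha : LukAxiom n a) :
    val e a = 1 := by
  have hI : ∀ k, e k ∈ Set.Icc (0 : ℚ) 1 := fun k => mem_Icc_of_mem_LV (he k)
  obtain ⟨hx, hx'⟩ := hI 0
  obtain ⟨hy, hy'⟩ := hI 1
  obtain ⟨hz, hz'⟩ := hI 2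
  have hn : (0 : ℚ) < n := Nat.cast_pos.2 (NeZero.pos n)
  -- the value `1 - d/n` in terms of the natural number `d`
  obtain ⟨d, hd⟩ : ∃ d : ℕ, 1 - e 0 = d / n := by
    obtain ⟨d, -, hd⟩ := neg_mem_LV n (he 0)
    exact ⟨d, hd⟩
  have hpow0 : 1 ≤ d → ∀ m, n ≤ m → (1 : ℚ) - m * (1 - e 0) ≤ 0 := fun h1 m hm => by
    have : (n : ℚ) ≤ m * d := by exact_mod_cast hm.trans (Nat.le_mul_of_pos_right m h1)
    rw [hd, mul_div_assoc', sub_nonpos, le_div_iff₀ hn]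
    linarith
  -- both sides of a divisor axiom are Boolean, and both are `1` exactly when `h * d < n`
  have hdiv : ∀ h, 2 ≤ h → ¬ h ∣ n →
      val e (nmul (n + 1) (npow h (var 0))) =
        val e (npow (n + 1) (nmul h (npow (h - 1) (var 0)))) := fun h h2 hh => by
    rw [val_nmul hI, val_npow hI, val_npow hI, val_nmul hI, val_npow hI,
      Nat.cast_sub (by omega : 1 ≤ h)]
    simp only [val]
    rw [hd]
    have hh0 : (2 : ℚ) ≤ h := by exact_mod_cast h2
    push_cast
    rcases lt_trichotomy (h * d) n with hlt | heq | hgt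
    · have h1 : (h : ℚ) * d + 1 ≤ n := by exact_mod_cast hlt
      have e1 : 1 / (n : ℚ) ≤ 1 - h * (d / n) := by
        rw [div_le_iff₀ hn, sub_mul, mul_assoc, div_mul_cancel₀ _ hn.ne']
        linarith
      have e2 : (1 : ℚ) ≤ (n + 1) * (1 - h * (d / n)) := by
        have := mul_le_mul_of_nonneg_left e1 (by linarith : (0 : ℚ) ≤ n + 1)
        refine le_trans ?_ this
        rw [mul_one_div, le_div_iff₀ hn]
        linarith
      have e3 : 1 ≤ h * (1 - (h - 1) * ((d : ℚ) / n)) := by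
        have h3 : (h : ℚ) * (d / n) ≤ 1 := by
          have : 0 < 1 / (n : ℚ) := by positivity
          linarith
        nlinarith
      have e4 : (0 : ℚ) < 1 / n := by positivity
      rw [max_eq_right (e4.le.trans e1), min_eq_left e2, max_eq_right (a := (0 : ℚ)) (b :=
        1 - (h - 1) * ((d : ℚ) / n)) (by nlinarith), min_eq_left e3]
      simp
    · exact absurd ⟨d, heq.symm⟩ hh
    · have h1 : (n : ℚ) + 1 ≤ h * d := by exact_mod_cast hgt
      have e1 : 1 + 1 / (n : ℚ) ≤ h * (d / n) := by
        rw [mul_div_assoc', le_div_iff₀ hn, add_mul, one_div_mul_cancel hn.ne']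
        linarith
      have e4 : (0 : ℚ) < 1 / n := by positivity
      have e5 : (h : ℚ) * max 0 (1 - (h - 1) * ((d : ℚ) / n)) ≤ 1 - 1 / n := by
        have h1n : 1 / (n : ℚ) ≤ 1 := by
          rw [div_le_one hn]
          exact_mod_cast NeZero.one_le
        rcases max_cases 0 (1 - (h - 1) * ((d : ℚ) / n)) with ⟨h3, -⟩ | ⟨h3, -⟩
        · rw [h3]; linarith
        · rw [h3]; nlinarith
      have e6 : (n + 1 : ℚ) * (1 / n) = 1 + 1 / n := by field_simp
      rw [max_eq_left (by linarith : 1 - (h : ℚ) * (d / n) ≤ 0), mul_zero,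
        min_eq_right zero_le_one, min_eq_right (by linarith), max_eq_left]
      nlinarith
  cases ha with
  | weakening => simp only [val]; grind
  | transitivity => simp only [val]; grind
  | join_comm => simp only [val]; grind
  | contraposition => simp only [val]; grind
  | linearity => simp only [val]; grind
  | contraction =>
    rw [val_imp_eq_one, val_npow hI, val_npow hI]
    simp only [val]
    rcases Nat.eq_zero_or_pos d with rfl | h1
    · simp [hd]
    · rw [max_eq_left (hpow0 h1 n le_rfl)]
      exact le_max_left _ _
  | contraction_conv =>
    rw [val_imp_eq_one, val_npow hI, val_npow hI]
    simp only [val]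
    exact max_le_max le_rfl (by push_cast; linarith)
  | divisor h h2 _ hh => rw [val_imp_eq_one, hdiv h h2 hh]
  | divisor_conv h h2 _ hh => rw [val_imp_eq_one, hdiv h h2 hh]

end Axioms

theorem logic_lukCalculus (n : ℕ) [NeZero n] : (lukCalculus n).logic = lukLogic n n := by
  refine le_antisymm (HilbertCalculus.logic_le_of_validates ?_) ?_
  · rintro r (⟨hp, hax⟩ | rfl)
    · exact lukLogic_self_entails_iff.2 fun e he _ => val_eq_one_of_lukAxiom he hax
    · refine lukLogic_self_entails_iff.2 fun e he h => ?_
      have h1 := h (var 0) (by simp)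
      have h2 := (val_imp_eq_one _ _).1 (h (imp (var 0) (var 1)) (by simp))
      exact le_antisymm (mem_Icc_of_mem_LV (val_mem_LV he _)).2 (h1 ▸ h2)
  · rw [PropLogic.le_iff]
    intro Γ φ h
    by_contra hder
    obtain ⟨Δ, hΓ, hmax⟩ := HilbertCalculus.exists_maximal_not_derives hder
    obtain ⟨e, he, hval⟩ := (LukTheory.ofMaximal hmax).exists_evaluation
      (LukTheory.total_of_maximal _ hmax) (φ := φ) fun h => hmax.prop (.hyp φ h)
    exact hmax.prop (.hyp φ ((hval φ).1
      (lukLogic_self_entails_iff.1 h e he fun ψ hψ => (hval ψ).2 (hΓ hψ))))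

section Translation

variable {i n : ℕ}

theorem subst_lam (s : ℕ → Fm) (a : Fm) : (lam i n a).subst s = lam i n (a.subst s) :=
  subst_lin s _ _ a

theorem translatedCalculus_derives_npow {Γ : Set Fm} {φ : Fm}
    (h : (lukCalculus n).Derives Γ φ) :
    (translatedCalculus i n).Derives (npow n '' Γ) (npow n φ) := by
  induction h with
  | hyp φ hφ => exact .hyp _ ⟨φ, hφ, rfl⟩
  | rule r s hr _ ih =>
    rw [← subst_npow]
    refine .rule ⟨r.prems.map (npow n), npow n r.concl⟩ s (Or.inl ⟨r, hr, rfl⟩) fun ψ hψ => ?_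
    obtain ⟨χ, hχ, rfl⟩ := List.mem_map.1 hψ
    rw [subst_npow]
    exact ih χ hχ

variable [NeZero n] {e : ℕ → ℚ}

/-- On the `(n+1)`-element chain `xⁿ` is `1` at `x = 1` and `0` elsewhere. -/
theorem le_val_npow_iff (hi : 0 < i) (hin : i ≤ n) (he : ∀ k, e k ∈ LV n) (a : Fm) :
    (i / n : ℚ) ≤ val e (npow n a) ↔ val e a = 1 := by
  have hI : ∀ k, e k ∈ Set.Icc (0 : ℚ) 1 := fun k => mem_Icc_of_mem_LV (he k)
  have hn : (0 : ℚ) < n := Nat.cast_pos.2 (NeZero.pos n)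
  have hi' : (0 : ℚ) < i / n := div_pos (Nat.cast_pos.2 hi) hn
  rw [val_npow hI]
  constructor
  · intro h
    refine (eq_one_or_le_of_mem_LV (val_mem_LV he a)).resolve_right fun hle => ?_
    rw [max_eq_left] at h
    · exact absurd h (not_le.2 hi')
    · have := mul_le_mul_of_nonneg_left hle hn.le
      rw [mul_sub, mul_one_div_cancel hn.ne'] at this
      linarith
  · intro h
    rw [h, sub_self, mul_zero, sub_zero, max_eq_right zero_le_one, div_le_one hn]
    exact_mod_cast hin

theorem val_lam_eq_one_iff (hi : 0 < i) (he : ∀ k, e k ∈ LV n) (a : Fm) :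
    val e (lam i n a) = 1 ↔ (i / n : ℚ) ≤ val e a := by
  have hI : ∀ k, e k ∈ Set.Icc (0 : ℚ) 1 := fun k => mem_Icc_of_mem_LV (he k)
  have hn : (0 : ℚ) < n := Nat.cast_pos.2 (NeZero.pos n)
  rw [lam, val_lin hI, min_eq_left_iff, le_max_iff, or_iff_right (by norm_num),
    Nat.cast_sub hi, div_le_iff₀ hn, Nat.cast_one]
  constructor <;> intro h <;> linarith

/-- Completeness is transferred along the translations `φ ↦ λ(φ)` and `φ ↦ φⁿ`, which are mutually
inverse up to interderivability. -/
theorem logic_translatedCalculus (hi : 0 < i) (hin : i ≤ n) :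
    (translatedCalculus i n).logic = lukLogic i n := by
  refine le_antisymm (HilbertCalculus.logic_le_of_validates ?_) ?_
  · rintro r (⟨r₀, hr₀, rfl⟩ | rfl | rfl)
    · refine lukLogic_entails_iff.2 fun e he h => (le_val_npow_iff hi hin he _).2 ?_
      have hv : (lukLogic n n).Validates r₀ := by
        rw [← logic_lukCalculus]
        exact HilbertCalculus.logic_validates hr₀
      refine lukLogic_self_entails_iff.1 hv e he fun ψ hψ => (le_val_npow_iff hi hin he _).1 ?_
      exact h _ (List.mem_map_of_mem hψ)
    · refine lukLogic_entails_iff.2 fun e he h => ?_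
      rw [le_val_npow_iff hi hin he, val_lam_eq_one_iff hi he]
      exact h _ (by simp)
    · refine lukLogic_entails_iff.2 fun e he h => ?_
      have h1 := h (npow n (lam i n (var 0))) (by simp)
      rwa [le_val_npow_iff hi hin he, val_lam_eq_one_iff hi he] at h1
  · rw [PropLogic.le_iff]
    intro Γ φ h
    have h1 : (lukLogic n n).entails (lam i n '' Γ) (lam i n φ) := by
      refine lukLogic_self_entails_iff.2 fun e he hΓ => (val_lam_eq_one_iff hi he φ).2 ?_
      exact lukLogic_entails_iff.1 h e he fun ψ hψ =>
        (val_lam_eq_one_iff hi he ψ).1 (hΓ _ ⟨ψ, hψ, rfl⟩)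
    rw [← logic_lukCalculus] at h1
    have intro_lam : ∀ ψ, (translatedCalculus i n).Derives Γ ψ →
        (translatedCalculus i n).Derives Γ (npow n (lam i n ψ)) := fun ψ hψ => by
      have := HilbertCalculus.Derives.rule (Γ := Γ) ⟨[var 0], npow n (lam i n (var 0))⟩
        (fun _ => ψ) (show _ ∈ translatedCalculus i n from Or.inr (Or.inl rfl)) fun χ hχ => by
          rw [List.mem_singleton.1 hχ]
          exact hψ
      rwa [subst_npow, subst_lam] at this
    have elim_lam : ∀ ψ, (translatedCalculus i n).Derives Γ (npow n (lam i n ψ)) →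
        (translatedCalculus i n).Derives Γ ψ := fun ψ hψ => by
      refine HilbertCalculus.Derives.rule (Γ := Γ) ⟨[npow n (lam i n (var 0))], var 0⟩
        (fun _ => ψ) (show _ ∈ translatedCalculus i n from Or.inr (Or.inr rfl)) ?_
      intro χ hχ
      rw [List.mem_singleton.1 hχ, subst_npow, subst_lam]
      exact hψ
    refine elim_lam φ ((translatedCalculus_derives_npow h1).cut ?_)
    rintro _ ⟨_, ⟨ψ, hψ, rfl⟩, rfl⟩
    exact intro_lam ψ (.hyp ψ hψ)

theorem logic_hilbertL (hi : 0 < i) (hin : i ≤ n) : (hilbertL i n).logic = lukLogic i n := by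
  rw [hilbertL]
  split_ifs with h
  · rw [logic_lukCalculus, h]
  · exact logic_translatedCalculus hi hin

end Translation

/-! ### Finitarity -/

/-- The logic of a finite matrix is finitary, by compactness of the space of assignments. -/
theorem LMatrix.isFinitary_logic (M : LMatrix) [Finite M.Carrier] : M.logic.IsFinitary := by
  intro Γ φ h
  let : TopologicalSpace M.Carrier := ⊥
  have : DiscreteTopology M.Carrier := ⟨rfl⟩
  have hcont : ∀ a, Continuous fun e : ℕ → M.Carrier => M.eval e a := by
    intro a
    induction a with
    | var k => exact continuous_apply k
    | neg a ih => exact continuous_of_discreteTopology.comp ih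
    | imp a b iha ihb =>
      exact (continuous_of_discreteTopology (f := fun p : M.Carrier × M.Carrier =>
        M.imp p.1 p.2)).comp (iha.prodMk ihb)
  have hclosed : ∀ (S : Set M.Carrier) a, IsClosed {e : ℕ → M.Carrier | M.eval e a ∈ S} :=
    fun S a => (isClosed_discrete S).preimage (hcont a)
  obtain ⟨u, hu⟩ := (hclosed M.desᶜ φ).isCompact.elim_finite_subfamily_closed
    (fun ψ : Γ => {e | M.eval e ψ ∈ M.des}) (fun ψ => hclosed _ _) (by
      rw [Set.eq_empty_iff_forall_notMem]
      rintro e ⟨hφ, hΓ⟩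
      exact hφ (h e fun ψ hψ => Set.mem_iInter.1 hΓ ⟨ψ, hψ⟩))
  refine ⟨Subtype.val '' (u : Set Γ), ?_, u.finite_toSet.image _, fun e he => ?_⟩
  · rintro _ ⟨ψ, -, rfl⟩
    exact ψ.2
  · by_contra hφ
    exact Set.eq_empty_iff_forall_notMem.1 hu e
      ⟨hφ, Set.mem_iInter₂.2 fun ψ hψ => he _ ⟨ψ, hψ, rfl⟩⟩

instance (i n : ℕ) [NeZero n] : Finite (chainMatrix i n).Carrier := by
  have h : (LV n).Finite := by
    refine ((Set.finite_Iic n).image fun k : ℕ => (k : ℚ) / n).subset ?_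
    rintro x ⟨k, hk, rfl⟩
    exact ⟨k, hk, rfl⟩
  exact h.to_subtype

instance (M N : LMatrix) [Finite M.Carrier] [Finite N.Carrier] : Finite (M.prod N).Carrier :=
  inferInstanceAs (Finite (M.Carrier × N.Carrier))

theorem isFinitary_lukLogic (i n : ℕ) [NeZero n] : (lukLogic i n).IsFinitary :=
  LMatrix.isFinitary_logic _

theorem isFinitary_lukBarLogic (i n : ℕ) [NeZero n] : (lukBarLogic i n).IsFinitary :=
  LMatrix.isFinitary_logic _

/-! ### Definable functions on a chain of prime length -/

section Definable

variable {q : ℕ} [Fact q.Prime]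

theorem one_le_of_mem_LV_of_notMem {n : ℕ} [NeZero n] {x : ℚ} (hx : x ∈ LV n) (hx' : x ∉ LV 1) :
    1 / (n : ℚ) ≤ x ∧ x ≤ 1 - 1 / n := by
  rw [mem_LV_one_iff, not_or] at hx'
  refine ⟨?_, (eq_one_or_le_of_mem_LV hx).resolve_left hx'.2⟩
  rcases eq_one_or_le_of_mem_LV (neg_mem_LV n hx) with h | h
  · exact absurd (by linarith) hx'.1
  · linarith

/-- The formula is a strong disjunction over `k ≤ K`, whose disjunct for `k` is `1/q` at `k/q`
and `0` elsewhere. It is built from terms `lin N M` because `k` is invertible modulo `q`. -/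
theorem exists_indicator_upto (K : ℕ) (hK : K < q) :
    ∃ D : Fm → Fm, ∀ e : ℕ → ℚ, (∀ k, e k ∈ LV q) → ∀ a (k : ℕ), val e a = k / q →
      val e (D a) = if 1 ≤ k ∧ k ≤ K then 1 / (q : ℚ) else 0 := by
  have hq : (0 : ℚ) < q := Nat.cast_pos.2 (NeZero.pos q)
  induction K with
  | zero =>
    refine ⟨falsum, fun e _ a k _ => ?_⟩
    rw [val_falsum, if_neg (by omega)]
  | succ K ih =>
    obtain ⟨D, hD⟩ := ih (by omega)
    obtain ⟨N, -, hN⟩ := Nat.exists_mul_mod_eq_one_of_coprime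
      ((Nat.coprime_of_lt_prime (by omega) hK (Fact.out : q.Prime)).symm)
      (Fact.out : q.Prime).one_lt
    -- `N (K+1) = 1 + M q`, so that `N x - M = 1/q` at `x = (K+1)/q`
    set M := (K + 1) * N / q with hM
    have hNM : ((K : ℚ) + 1) * N = 1 + q * M := by
      have := Nat.mod_add_div ((K + 1) * N) q
      rw [hN, ← hM] at this
      exact_mod_cast this.symm
    refine ⟨fun a => oplus (D a)
      (otimes (otimes (lin q K a) (neg (lin q (K + 1) a))) (lin N M a)), fun e he a k hk => ?_⟩
    have hI : ∀ k, e k ∈ Set.Icc (0 : ℚ) 1 := fun k => mem_Icc_of_mem_LV (he k)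
    have hlin : ∀ K : ℕ, val e (lin q K a) = min 1 (max 0 ((k : ℚ) - K)) := fun K => by
      rw [val_lin hI, hk, mul_div_cancel₀ _ hq.ne']
    have hq1 : 1 / (q : ℚ) ≤ 1 := by
      rw [div_le_one hq]
      exact_mod_cast NeZero.one_le
    have hq0 : (0 : ℚ) < 1 / q := by positivity
    obtain ⟨hl0, hl1⟩ := val_mem_Icc hI (lin N M a)
    -- on the chain, `lin q K` is the characteristic function of the values above `K/q`
    have hχ : val e (otimes (lin q K a) (neg (lin q (K + 1) a))) =
        if k = K + 1 then 1 else 0 := by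
      rw [val_otimes, hlin, val, hlin, Nat.cast_succ, ← sub_sub]
      rcases lt_trichotomy k (K + 1) with h | rfl | h
      · have h' : (k : ℚ) ≤ K := by exact_mod_cast Nat.le_of_lt_succ h
        rw [if_neg h.ne, max_eq_left (by linarith : (k : ℚ) - K ≤ 0),
          max_eq_left (by linarith : (k : ℚ) - K - 1 ≤ 0)]
        norm_num
      · rw [if_pos rfl, Nat.cast_succ, add_sub_cancel_left]
        norm_num
      · have h' : (K : ℚ) + 1 + 1 ≤ k := by exact_mod_cast h
        rw [if_neg h.ne', max_eq_right (by linarith : 0 ≤ (k : ℚ) - K),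
          max_eq_right (by linarith : 0 ≤ (k : ℚ) - K - 1), min_eq_left (by linarith),
          min_eq_left (by linarith)]
        norm_num
    rw [val_oplus, hD e he a k hk, val_otimes, hχ]
    by_cases h : k = K + 1
    · subst h
      have e1 : val e (lin N M a) = 1 / q := by
        rw [val_lin hI, hk, mul_div_assoc', Nat.cast_succ, mul_comm (N : ℚ), hNM, add_div,
          mul_div_cancel_left₀ _ hq.ne', add_sub_cancel_right, max_eq_right hq0.le,
          min_eq_right hq1]
      rw [e1, if_pos rfl, if_neg (by omega), if_pos (by omega), zero_add, add_sub_cancel_left,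
        max_eq_right hq0.le, min_eq_right hq1]
    · have h1 : (1 ≤ k ∧ k ≤ K) ↔ (1 ≤ k ∧ k ≤ K + 1) := by omega
      rw [if_neg h, max_eq_left (by linarith), add_zero, min_eq_right]
      · simp only [h1]
      · split_ifs
        exacts [hq1, zero_le_one]

/-- For prime `q` every nonclassical value generates the whole chain, so that any assignment of one
value to the nonclassical arguments and of a Boolean value to the classical ones is definable. -/
theorem exists_term {x b : ℚ} (hx : x ∈ LV q) (hb : b ∈ LV 1) :
    ∃ D : Fm → Fm, ∀ e : ℕ → ℚ, (∀ k, e k ∈ LV q) → ∀ a,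
      (val e a ∈ LV 1 → val e (D a) = b) ∧ (val e a ∉ LV 1 → val e (D a) = x) := by
  have hq : (0 : ℚ) < q := Nat.cast_pos.2 (NeZero.pos q)
  obtain ⟨D, hD⟩ := exists_indicator_upto (q := q) (q - 1) (Nat.sub_lt (NeZero.pos q) one_pos)
  have key : ∀ e : ℕ → ℚ, (∀ k, e k ∈ LV q) → ∀ a,
      (val e a ∈ LV 1 → val e (D a) = 0) ∧ (val e a ∉ LV 1 → val e (D a) = 1 / q) := by
    intro e he a
    obtain ⟨k, hk, hka⟩ := val_mem_LV he a
    rw [hD e he a k hka, hka, mem_LV_one_iff, div_eq_zero_iff, div_eq_one_iff_eq hq.ne',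
      or_iff_left hq.ne', Nat.cast_eq_zero, Nat.cast_inj]
    have := NeZero.pos q
    exact ⟨fun h => if_neg (by omega), fun h => if_pos (by omega)⟩
  obtain ⟨k, hk, rfl⟩ := hx
  have hk' : (k : ℚ) / q ≤ 1 := (div_le_one hq).2 (by exact_mod_cast hk)
  have hk0 : 0 ≤ (k : ℚ) / q := by positivity
  rcases mem_LV_one_iff.1 hb with rfl | rfl
  · refine ⟨fun a => nmul k (D a), fun e he a => ?_⟩
    have hI : ∀ k, e k ∈ Set.Icc (0 : ℚ) 1 := fun k => mem_Icc_of_mem_LV (he k)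
    rw [val_nmul hI]
    refine ⟨fun h => ?_, fun h => ?_⟩
    · rw [(key e he a).1 h, mul_zero, min_eq_right zero_le_one]
    · rw [(key e he a).2 h, mul_one_div, min_eq_right hk']
  · -- the value `1` at classical arguments comes from the negation of the case `b = 0`
    refine ⟨fun a => neg (nmul (q - k) (D a)), fun e he a => ?_⟩
    have hI : ∀ k, e k ∈ Set.Icc (0 : ℚ) 1 := fun k => mem_Icc_of_mem_LV (he k)
    rw [val, val_nmul hI, Nat.cast_sub hk]
    refine ⟨fun h => ?_, fun h => ?_⟩
    · rw [(key e he a).1 h, mul_zero, min_eq_right zero_le_one, sub_zero]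
    · rw [(key e he a).2 h, mul_one_div, sub_div, div_self hq.ne', min_eq_right (by linarith),
        sub_sub_cancel]

/-- Two evaluations, the second one classical, are merged into a substitution by formulas in one
variable, which simulates the first if that variable is nonclassical and the second otherwise. -/
theorem exists_subst {e₁ e₂ : ℕ → ℚ} (he₁ : ∀ k, e₁ k ∈ LV q) (he₂ : ∀ k, e₂ k ∈ LV 1) :
    ∃ s : ℕ → Fm, ∀ e : ℕ → ℚ, (∀ k, e k ∈ LV q) → ∀ a,
      (e 0 ∈ LV 1 → val e (a.subst s) = val e₂ a) ∧
        (e 0 ∉ LV 1 → val e (a.subst s) = val e₁ a) := by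
  choose D hD using fun k => exists_term (he₁ k) (he₂ k)
  refine ⟨fun k => D k (var 0), fun e he a => ⟨fun h => ?_, fun h => ?_⟩⟩
  · rw [val_subst]
    congr 1
    exact funext fun k => (hD k e he (var 0)).1 h
  · rw [val_subst]
    congr 1
    exact funext fun k => (hD k e he (var 0)).2 h

/-- A formula that is nonclassical as soon as one of the first `m` variables is. -/
theorem exists_nonclassical (m : ℕ) :
    ∃ a : Fm, ∀ e : ℕ → ℚ, (∀ k, e k ∈ LV q) → val e a ∈ LV 1 → ∀ k < m, e k ∈ LV 1 := by
  have hq : (2 : ℚ) ≤ q := by exact_mod_cast (Fact.out : q.Prime).two_le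
  have hq0 : (0 : ℚ) < 1 / q := by positivity
  have hq1 : (1 : ℚ) / q < 1 := by rw [div_lt_one] <;> linarith
  obtain ⟨D, hD⟩ := exists_term (q := q) (x := 1 / q) (b := 0)
    ⟨1, NeZero.one_le, by simp⟩ (zero_mem_LV 1)
  suffices h : ∃ a : Fm, ∀ e : ℕ → ℚ, (∀ k, e k ∈ LV q) →
      (val e a = 0 ∧ ∀ k < m, e k ∈ LV 1) ∨ val e a = 1 / q by
    obtain ⟨a, ha⟩ := h
    refine ⟨a, fun e he hc => ((ha e he).resolve_right fun h => ?_).2⟩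
    rw [h, mem_LV_one_iff] at hc
    rcases hc with hc | hc <;> linarith
  induction m with
  | zero => exact ⟨falsum (var 0), fun e _ => Or.inl ⟨val_falsum _, fun k hk => by omega⟩⟩
  | succ m ih =>
    obtain ⟨a, ha⟩ := ih
    -- the join of the two formulas; a sum could leave `{0, 1/q}` and become classical
    refine ⟨imp (imp a (D (var m))) (D (var m)), fun e he => ?_⟩
    simp only [val]
    by_cases hm : e m ∈ LV 1
    · rw [(hD e he (var m)).1 hm]
      rcases ha e he with ⟨h0, hk⟩ | h0
      · refine Or.inl ⟨by rw [h0]; norm_num, fun k hkm => ?_⟩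
        rcases (Nat.lt_succ_iff_lt_or_eq).1 hkm with h | rfl
        exacts [hk k h, hm]
      · right
        rw [h0]
        grind
    · right
      rw [(hD e he (var m)).2 hm]
      rcases ha e he with ⟨h0, -⟩ | h0 <;> rw [h0] <;> grind

end Definable

/-! ### The logics between `𝖫ʲ_q` and classical logic -/

section Interval

variable {q : ℕ} [Fact q.Prime] {j : ℕ}

theorem le_iff_eq_one_of_mem_LV_one (hj : 0 < j) (hjq : j ≤ q) {x : ℚ} (hx : x ∈ LV 1) :
    (j / q : ℚ) ≤ x ↔ x = 1 := by
  have hq : (0 : ℚ) < q := Nat.cast_pos.2 (NeZero.pos q)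
  have h0 : (0 : ℚ) < j / q := div_pos (Nat.cast_pos.2 hj) hq
  have h1 : (j / q : ℚ) ≤ 1 := (div_le_one hq).2 (by exact_mod_cast hjq)
  rcases mem_LV_one_iff.1 hx with rfl | rfl
  · exact ⟨fun h => by linarith, fun h => by linarith⟩
  · simpa using h1

/-- A value `x` of the chain has `min x (1 - x) ≥ 1/q` or `min x (1 - x) = 0`, so that the premise
of the explosion rule expresses that `x` is nonclassical. -/
theorem le_val_explosion_iff (hj : 0 < j) (hjq : j ≤ q) {e : ℕ → ℚ} (he : ∀ k, e k ∈ LV q)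
    (a : Fm) : (j / q : ℚ) ≤ val e (nmul j (conj a (neg a))) ↔ val e a ∉ LV 1 := by
  have hI : ∀ k, e k ∈ Set.Icc (0 : ℚ) 1 := fun k => mem_Icc_of_mem_LV (he k)
  have hq : (0 : ℚ) < q := Nat.cast_pos.2 (NeZero.pos q)
  have hj' : (0 : ℚ) < j := Nat.cast_pos.2 hj
  have h0 : (0 : ℚ) < j / q := div_pos hj' hq
  have h1 : (j / q : ℚ) ≤ 1 := (div_le_one hq).2 (by exact_mod_cast hjq)
  rw [val_nmul hI, val_conj hI, val]
  constructor
  · intro h hc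
    refine absurd h (not_le.2 (lt_of_eq_of_lt ?_ h0))
    rcases mem_LV_one_iff.1 hc with hc | hc <;> rw [hc] <;> norm_num
  · intro h
    obtain ⟨h2, h3⟩ := one_le_of_mem_LV_of_notMem (val_mem_LV he a) h
    refine le_min h1 ?_
    rw [div_eq_mul_one_div]
    exact mul_le_mul_of_nonneg_left (le_min h2 (by linarith)) hj'.le

theorem lukLogic_entails_of_falsum (hj : 0 < j) {Γ : Set Fm} {a : Fm} (h : falsum a ∈ Γ) (φ : Fm) :
    (lukLogic j q).entails Γ φ := by
  refine lukLogic_entails_iff.2 fun e _ hΓ => absurd (hΓ _ h) (not_le.2 ?_)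
  rw [val_falsum]
  exact div_pos (Nat.cast_pos.2 hj) (Nat.cast_pos.2 (NeZero.pos q))

theorem lukBarLogic_entails_iff {Γ : Set Fm} {φ : Fm} :
    (lukBarLogic j q).entails Γ φ ↔ ∀ e₁ e₂ : ℕ → ℚ, (∀ k, e₁ k ∈ LV q) → (∀ k, e₂ k ∈ LV 1) →
      (∀ ψ ∈ Γ, (j / q : ℚ) ≤ val e₁ ψ) → (∀ ψ ∈ Γ, val e₂ ψ = 1) →
        (j / q : ℚ) ≤ val e₁ φ ∧ val e₂ φ = 1 := by
  rw [lukBarLogic, prod_logic_entails_iff]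
  constructor
  · intro h e₁ e₂ he₁ he₂ h₁ h₂
    have := h (fun k => ⟨e₁ k, he₁ k⟩) (fun k => ⟨e₂ k, he₂ k⟩)
      (fun ψ hψ => (eval_mem_des_iff _ ψ).2 (h₁ ψ hψ))
      (fun ψ hψ => (eval_mem_des_self_iff _ ψ).2 (h₂ ψ hψ))
    exact ⟨(eval_mem_des_iff _ φ).1 this.1, (eval_mem_des_self_iff _ φ).1 this.2⟩
  · intro h e₁ e₂ h₁ h₂
    have := h _ _ (fun k => (show LV q from e₁ k).2) (fun k => (show LV 1 from e₂ k).2)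
      (fun ψ hψ => (eval_mem_des_iff _ ψ).1 (h₁ ψ hψ))
      (fun ψ hψ => (eval_mem_des_self_iff _ ψ).1 (h₂ ψ hψ))
    exact ⟨(eval_mem_des_iff _ φ).2 this.1, (eval_mem_des_self_iff _ φ).2 this.2⟩

theorem not_validates_expRule (hj : 0 < j) (hjq : j ≤ q) :
    ¬ (lukLogic j q).Validates (expRule j) := by
  intro h
  have hq : (2 : ℚ) ≤ q := by exact_mod_cast (Fact.out : q.Prime).two_le
  have hq1 : (1 : ℚ) / q < 1 := by rw [div_lt_one] <;> linarith
  have he : ∀ _ : ℕ, (1 / q : ℚ) ∈ LV q := fun _ => ⟨1, NeZero.one_le, by simp⟩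
  have h1 := lukLogic_entails_iff.1 h (fun _ => 1 / q) he fun ψ hψ => by
    rw [List.mem_singleton.1 hψ, le_val_explosion_iff hj hjq he, val, mem_LV_one_iff, not_or]
    exact ⟨by positivity, hq1.ne⟩
  rw [expRule, val_falsum] at h1
  exact absurd h1 (not_le.2 (div_pos (Nat.cast_pos.2 hj) (by linarith)))

theorem lukBarLogic_validates_expRule (j : ℕ) : (lukBarLogic j q).Validates (expRule j) := by
  refine lukBarLogic_entails_iff.2 fun e₁ e₂ _ he₂ _ h => ?_
  have hI : ∀ k, e₂ k ∈ Set.Icc (0 : ℚ) 1 := fun k => mem_Icc_of_mem_LV (he₂ k)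
  have h1 := h (nmul j (conj (var 0) (neg (var 0)))) (by simp [expRule])
  rw [val_nmul hI, val_conj hI] at h1
  simp only [val] at h1
  rcases mem_LV_one_iff.1 (he₂ 0) with h0 | h0 <;> rw [h0] at h1 <;> norm_num at h1

theorem lukLogic_le_lukBarLogic (hj : 0 < j) (hjq : j ≤ q) : lukLogic j q ≤ lukBarLogic j q := by
  refine (PropLogic.le_iff _ _).2 fun Γ φ h => lukBarLogic_entails_iff.2
    fun e₁ e₂ he₁ he₂ h₁ h₂ => ⟨lukLogic_entails_iff.1 h e₁ he₁ h₁, ?_⟩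
  have hsub : ∀ k, e₂ k ∈ LV q := fun k => LV_subset_of_dvd (one_dvd q) (he₂ k)
  refine (le_iff_eq_one_of_mem_LV_one hj hjq (val_mem_LV he₂ φ)).1
    (lukLogic_entails_iff.1 h e₂ hsub fun ψ hψ => ?_)
  exact (le_iff_eq_one_of_mem_LV_one hj hjq (val_mem_LV he₂ ψ)).2 (h₂ ψ hψ)

theorem lukBarLogic_le_CPL (hj : 0 < j) (hjq : j ≤ q) : lukBarLogic j q ≤ CPL := by
  refine (PropLogic.le_iff _ _).2 fun Γ φ h => CPL_entails_iff.2 fun e he hΓ => ?_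
  refine (lukBarLogic_entails_iff.1 h e e (fun k => LV_subset_of_dvd (one_dvd q) (he k)) he
    (fun ψ hψ => ?_) hΓ).2
  exact (le_iff_eq_one_of_mem_LV_one hj hjq (val_mem_LV he ψ)).2 (hΓ ψ hψ)

theorem not_CPL_le_lukBarLogic (hj : 0 < j) : ¬ CPL ≤ lukBarLogic j q := by
  intro hle
  have hq : (2 : ℚ) ≤ q := by exact_mod_cast (Fact.out : q.Prime).two_le
  have hq1 : (1 : ℚ) / q < 1 := by rw [div_lt_one] <;> linarith
  -- the formula saying that a variable is classical is a tautology of `CPL` only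
  obtain ⟨D, hD⟩ := exists_term (q := q) (zero_mem_LV q) (one_mem_LV 1)
  have hCPL : CPL.entails ∅ (D (var 0)) := CPL_entails_iff.2 fun e he _ =>
    (hD e (fun k => LV_subset_of_dvd (one_dvd q) (he k)) (var 0)).1 (he 0)
  have he : ∀ _ : ℕ, (1 / q : ℚ) ∈ LV q := fun _ => ⟨1, NeZero.one_le, by simp⟩
  have h := (lukBarLogic_entails_iff.1 ((PropLogic.le_iff _ _).1 hle _ _ hCPL) (fun _ => 1 / q)
    (fun _ => 0) he (fun _ => zero_mem_LV 1) (by simp) (by simp)).1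
  rw [(hD _ he (var 0)).2] at h
  · exact absurd h (not_le.2 (div_pos (Nat.cast_pos.2 hj) (by linarith)))
  · rw [val, mem_LV_one_iff, not_or]
    exact ⟨by positivity, hq1.ne⟩

/-- A counterexample in the chain to an entailment of `L` yields, through a substitution that
reproduces it at every nonclassical value of one variable, the explosion rule in `L`. -/
theorem le_lukLogic_of_not_validates (hj : 0 < j) (hjq : j ≤ q) {L : PropLogic}
    (hL : lukLogic j q ≤ L) (hexp : ¬ L.Validates (expRule j)) : L ≤ lukLogic j q := by
  rw [PropLogic.le_iff] at hL ⊢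
  intro Γ φ h
  by_contra hcon
  rw [lukLogic_entails_iff] at hcon
  push Not at hcon
  obtain ⟨e, he, hΓ, hφ⟩ := hcon
  obtain ⟨s, hs⟩ := exists_subst he (fun _ => zero_mem_LV 1)
  refine hexp ?_
  set P : Set Fm := {φ | φ ∈ (expRule j).prems} with hP
  have hmem : nmul j (conj (var 0) (neg (var 0))) ∈ P := by simp [hP, expRule]
  have h1 : L.entails P (φ.subst s) := by
    refine L.cut _ _ _ ?_ (L.structural s _ _ h)
    rintro _ ⟨ψ, hψ, rfl⟩
    refine hL _ _ (lukLogic_entails_iff.2 fun e' he' h' => ?_)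
    have := (le_val_explosion_iff hj hjq he' (var 0)).1 (h' _ hmem)
    rw [(hs e' he' ψ).2 this]
    exact hΓ ψ hψ
  refine L.cut P (insert (φ.subst s) P) _ ?_ (hL _ _ (lukLogic_entails_iff.2 fun e' he' h' => ?_))
  · rintro ψ (rfl | hψ)
    exacts [h1, L.refl _ _ hψ]
  · have h2 := (le_val_explosion_iff hj hjq he' (var 0)).1 (h' _ (Or.inr hmem))
    have h3 := h' _ (Or.inl rfl)
    rw [(hs e' he' φ).2 h2] at h3
    exact absurd h3 (not_le.2 hφ)

/-- If `Γ` is classically unsatisfiable, then by compactness some formula is nonclassical whenever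
`Γ` holds, and the explosion rule applies to it. -/
theorem lukBarLogic_le_of_validates (hj : 0 < j) (hjq : j ≤ q) {L : PropLogic}
    (hL : lukLogic j q ≤ L) (hexp : L.Validates (expRule j)) : lukBarLogic j q ≤ L := by
  have hpos : (0 : ℚ) < j / q := div_pos (Nat.cast_pos.2 hj) (Nat.cast_pos.2 (NeZero.pos q))
  rw [PropLogic.le_iff] at hL ⊢
  intro Γ φ h
  rw [lukBarLogic_entails_iff] at h
  by_cases hsat : ∃ e₂ : ℕ → ℚ, (∀ k, e₂ k ∈ LV 1) ∧ ∀ ψ ∈ Γ, val e₂ ψ = 1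
  · obtain ⟨e₂, he₂, h₂⟩ := hsat
    exact hL _ _ (lukLogic_entails_iff.2 fun e₁ he₁ h₁ => (h e₁ e₂ he₁ he₂ h₁ h₂).1)
  -- `C` takes the value `1` at classical arguments and `0` at nonclassical ones
  obtain ⟨C, hC⟩ := exists_term (q := q) (zero_mem_LV q) (one_mem_LV 1)
  have hcl : ∀ e : ℕ → ℚ, (∀ k, e k ∈ LV q) → ∀ k, (j / q : ℚ) ≤ val e (C (var k)) ↔
      e k ∈ LV 1 := fun e he k => by
    by_cases hk : e k ∈ LV 1
    · rw [(hC e he (var k)).1 hk]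
      exact iff_of_true ((le_iff_eq_one_of_mem_LV_one hj hjq (one_mem_LV 1)).2 rfl) hk
    · rw [(hC e he (var k)).2 hk]
      exact iff_of_false (not_le.2 hpos) hk
  have hbot : (lukLogic j q).entails (Γ ∪ Set.range fun k => C (var k)) (falsum (var 0)) := by
    refine lukLogic_entails_iff.2 fun e he hall => absurd ?_ hsat
    have hc : ∀ k, e k ∈ LV 1 := fun k => (hcl e he k).1 (hall _ (Or.inr ⟨k, rfl⟩))
    exact ⟨e, hc, fun ψ hψ =>
      (le_iff_eq_one_of_mem_LV_one hj hjq (val_mem_LV hc ψ)).1 (hall _ (Or.inl hψ))⟩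
  obtain ⟨Δ, hΔ, hfin, hder⟩ := isFinitary_lukLogic j q _ _ hbot
  have hind : ∀ ψ ∈ Δ, ∃ k, ψ ∈ Γ ∨ C (var k) = ψ := fun ψ hψ => by
    rcases hΔ hψ with h | ⟨k, hk⟩
    exacts [⟨0, Or.inl h⟩, ⟨k, Or.inr hk⟩]
  choose! g hg using hind
  obtain ⟨m, hm⟩ := (hfin.image g).bddAbove
  obtain ⟨X, hX⟩ := exists_nonclassical (q := q) (m + 1)
  have h1 : (lukLogic j q).entails Γ (nmul j (conj X (neg X))) := by
    refine lukLogic_entails_iff.2 fun e he hΓ => ?_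
    rw [le_val_explosion_iff hj hjq he]
    intro hcX
    have := lukLogic_entails_iff.1 hder e he fun ψ hψ => by
      rcases hg ψ hψ with h' | h'
      · exact hΓ ψ h'
      · rw [← h', hcl e he]
        exact hX e he hcX _ (Nat.lt_succ_of_le (hm ⟨ψ, hψ, rfl⟩))
    rw [val_falsum] at this
    exact absurd this (not_le.2 hpos)
  have h2 := L.structural (fun _ => X) _ _ hexp
  refine L.cut Γ {falsum X} φ ?_ (hL _ _ (lukLogic_entails_of_falsum hj (Set.mem_singleton _) φ))
  intro ψ hψ
  rw [Set.mem_singleton_iff.1 hψ]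
  refine L.cut _ _ _ ?_ h2
  rintro _ ⟨χ, hχ, rfl⟩
  rw [List.mem_singleton.1 hχ, subst_nmul]
  exact hL _ _ h1

/-- An entailment of `L` that fails in `𝖫̄ʲ_q` has a counterexample in which its premises hold both
in the chain and classically. The substitution that merges both evaluations turns its conclusion
into a theorem of `L` that is designated only at classical values. -/
theorem CPL_le_of_ne (hj : 0 < j) (hjq : j ≤ q) {L : PropLogic} (hL : lukBarLogic j q ≤ L)
    (hne : L ≠ lukBarLogic j q) (hCPL : L ≤ CPL) : CPL ≤ L := by
  have hLL := (PropLogic.le_iff _ _).1 ((lukLogic_le_lukBarLogic hj hjq).trans hL)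
  have hone : (j / q : ℚ) ≤ 1 := (le_iff_eq_one_of_mem_LV_one hj hjq (one_mem_LV 1)).2 rfl
  have hnle : ¬ L ≤ lukBarLogic j q := fun h => hne (le_antisymm h hL)
  rw [PropLogic.le_iff] at hnle hCPL ⊢
  push Not at hnle
  obtain ⟨Γ, φ, hφ, hnφ⟩ := hnle
  rw [lukBarLogic_entails_iff] at hnφ
  push Not at hnφ
  obtain ⟨e₁, e₂, he₁, he₂, h₁, h₂, h₃⟩ := hnφ
  have hφ₂ : val e₂ φ = 1 := CPL_entails_iff.1 (hCPL _ _ hφ) e₂ he₂ h₂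
  have hφ₁ : ¬ (j / q : ℚ) ≤ val e₁ φ := fun h => h₃ h hφ₂
  obtain ⟨s, hs⟩ := exists_subst he₁ he₂
  have hthm : L.entails ∅ (φ.subst s) := by
    refine L.cut _ _ _ ?_ (L.structural s _ _ hφ)
    rintro _ ⟨ψ, hψ, rfl⟩
    refine hLL _ _ (lukLogic_entails_iff.2 fun e he _ => ?_)
    by_cases h0 : e 0 ∈ LV 1
    · rw [(hs e he ψ).1 h0, h₂ ψ hψ]
      exact hone
    · rw [(hs e he ψ).2 h0]
      exact h₁ ψ hψ
  have hthm' : ∀ k, L.entails ∅ ((φ.subst s).subst fun _ => var k) := fun k => by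
    have := L.structural (fun _ => var k) _ _ hthm
    rwa [Set.image_empty] at this
  intro Γ' φ' h
  refine L.cut Γ' (Γ' ∪ Set.range fun k => (φ.subst s).subst fun _ => var k) φ' ?_
    (hLL _ _ (lukLogic_entails_iff.2 fun e he hall => ?_))
  · rintro ψ (hψ | ⟨k, rfl⟩)
    · exact L.refl _ _ hψ
    · exact L.cut _ ∅ _ (by simp) (hthm' k)
  · have hc : ∀ k, e k ∈ LV 1 := fun k => by
      by_contra hk
      have h' := hall _ (Or.inr ⟨k, rfl⟩)
      rw [val_subst] at h'
      change (j / q : ℚ) ≤ val (fun _ => e k) (φ.subst s) at h'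
      rw [(hs (fun _ => e k) (fun _ => he k) φ).2 hk] at h'
      exact hφ₁ h'
    have hΓ' : ∀ ψ ∈ Γ', val e ψ = 1 := fun ψ hψ =>
      (le_iff_eq_one_of_mem_LV_one hj hjq (val_mem_LV hc ψ)).1 (hall _ (Or.inl hψ))
    rw [CPL_entails_iff.1 h e hc hΓ']
    exact hone

theorem lukLogic_lt_lukBarLogic (hj : 0 < j) (hjq : j ≤ q) : lukLogic j q < lukBarLogic j q :=
  lt_of_le_not_ge (lukLogic_le_lukBarLogic hj hjq) fun h =>
    not_validates_expRule hj hjq ((PropLogic.le_iff _ _).1 h _ _ (lukBarLogic_validates_expRule j))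

theorem lukBarLogic_lt_CPL (hj : 0 < j) (hjq : j ≤ q) : lukBarLogic j q < CPL :=
  lt_of_le_not_ge (lukBarLogic_le_CPL hj hjq) (not_CPL_le_lukBarLogic hj)

theorem lt_and_lt_CPL_iff (hj : 0 < j) (hjq : j ≤ q) {L : PropLogic} :
    lukLogic j q < L ∧ L < CPL ↔ L = lukBarLogic j q := by
  constructor
  · rintro ⟨h₁, h₂⟩
    have hexp : L.Validates (expRule j) := by
      by_contra hexp
      exact h₁.not_ge (le_lukLogic_of_not_validates hj hjq h₁.le hexp)
    by_contra hne
    exact h₂.not_ge (CPL_le_of_ne hj hjq (lukBarLogic_le_of_validates hj hjq h₁.le hexp) hne h₂.le)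
  · rintro rfl
    exact ⟨lukLogic_lt_lukBarLogic hj hjq, lukBarLogic_lt_CPL hj hjq⟩

theorem PropLogic.le_addRule (L : PropLogic) (r : FRule) : L ≤ L.addRule r :=
  (PropLogic.le_iff _ _).2 fun Γ φ h _ hL _ => (PropLogic.le_iff _ _).1 hL Γ φ h

theorem PropLogic.addRule_validates (L : PropLogic) (r : FRule) : (L.addRule r).Validates r :=
  fun _ _ hr => hr

theorem PropLogic.addRule_le {L L' : PropLogic} {r : FRule} (hL : L ≤ L') (hr : L'.Validates r) :
    L.addRule r ≤ L' :=
  (PropLogic.le_iff _ _).2 fun _ _ h => h L' hL hr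

theorem le_and_stronglyMaximal_iff (hj : 0 < j) (hjq : j ≤ q) {L : PropLogic} :
    lukLogic j q ≤ L ∧ StronglyMaximal L CPL ↔ L = lukBarLogic j q := by
  constructor
  · rintro ⟨hL, hlt, hmax⟩
    rcases hL.eq_or_lt with rfl | hL
    · -- the explosion rule only leads from `𝖫ʲ_q` to `𝖫̄ʲ_q`
      have hCPL := lukBarLogic_lt_CPL hj hjq
      have h := hmax (expRule j)
        ((PropLogic.le_iff _ _).1 hCPL.le _ _ (lukBarLogic_validates_expRule j))
        (not_validates_expRule hj hjq)
      have h' := PropLogic.addRule_le (lukLogic_le_lukBarLogic hj hjq)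
        (lukBarLogic_validates_expRule (q := q) j)
      rw [h] at h'
      exact absurd h' hCPL.not_ge
    · exact (lt_and_lt_CPL_iff hj hjq).1 ⟨hL, hlt⟩
  · rintro rfl
    have hCPL := lukBarLogic_lt_CPL hj hjq
    refine ⟨lukLogic_le_lukBarLogic hj hjq, hCPL, fun r hr hnr => ?_⟩
    have h := PropLogic.addRule_le hCPL.le hr
    refine le_antisymm h (CPL_le_of_ne hj hjq (PropLogic.le_addRule _ r) (fun heq => hnr ?_) h)
    have := PropLogic.addRule_validates (lukBarLogic j q) r
    rwa [heq] at this

theorem logic_addExp (hj : 0 < j) (hjq : j ≤ q) {H : HilbertCalculus}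
    (hH : H.logic = lukLogic j q) : (addExp H j).logic = lukBarLogic j q := by
  refine le_antisymm (HilbertCalculus.logic_le_of_validates ?_)
    (lukBarLogic_le_of_validates hj hjq (hH ▸ HilbertCalculus.logic_mono (Set.subset_insert _ H))
      (HilbertCalculus.logic_validates (Set.mem_insert _ H)))
  rintro r (rfl | hr)
  · exact lukBarLogic_validates_expRule j
  · refine (PropLogic.le_iff _ _).1 (lukLogic_le_lukBarLogic hj hjq) _ _ ?_
    rw [← hH]
    exact HilbertCalculus.logic_validates hr

end Interval

end FinLuk

theorem mainTheorem7 (q : ℕ) [Fact q.Prime] (j : ℕ) (hj : 0 < j) (hjq : j ≤ q) :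
    -- the three logics are standard (finitary and structural)
    ((lukLogic j q).IsFinitary ∧ (lukBarLogic j q).IsFinitary ∧ CPL.IsFinitary) ∧
    -- `lukBarLogic j q` is the unique logic strictly between `lukLogic j q` and `CPL`
    (∀ L : PropLogic, (lukLogic j q < L ∧ L < CPL) ↔ L = lukBarLogic j q) ∧
    -- it is the unique logic above `lukLogic j q` that is strongly maximal with respect to `CPL`
    (∀ L : PropLogic, (lukLogic j q ≤ L ∧ StronglyMaximal L CPL) ↔ L = lukBarLogic j q) ∧
    -- the calculus for `lukLogic j q`, and its extension by the explosion rule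
    (hilbertL j q).SoundComplete (lukLogic j q) ∧
    (addExp (hilbertL j q) j).SoundComplete (lukBarLogic j q) ∧
    -- the same for any other sound and complete calculus for `lukLogic j q`
    (∀ H : HilbertCalculus, H.SoundComplete (lukLogic j q) →
      (addExp H j).SoundComplete (lukBarLogic j q)) := by
  have hH := logic_hilbertL hj hjq
  refine ⟨⟨isFinitary_lukLogic j q, isFinitary_lukBarLogic j q, isFinitary_lukLogic 1 1⟩,
    fun L => lt_and_lt_CPL_iff hj hjq, fun L => le_and_stronglyMaximal_iff hj hjq,
    HilbertCalculus.soundComplete_iff.2 hH,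
    HilbertCalculus.soundComplete_iff.2 (logic_addExp hj hjq hH), fun H h => ?_⟩
  exact HilbertCalculus.soundComplete_iff.2
    (logic_addExp hj hjq (HilbertCalculus.soundComplete_iff.1 h))
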